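/- Let $(\Omega,\mathcal F_T,P)$ be a probability space and $\mathcal F_t\subseteq\mathcal F_T$ a sub-$\sigma$-algebra. For $s\in\{t,T\}$ let $L^\infty_s$ be the essentially bounded real $\mathcal F_s$-measurable random variables and $L^{bb}_s$ the $\mathcal F_s$-measurable random variables, possibly $+\infty$-valued, that are essentially bounded from below. (In)equalities hold $P$-a.s., and $0\cdot\infty=0$. A *conditional performance measure* (CPM) is a map $\beta_t:L^{bb}_T\to L^{bb}_t$ such that: 1. $\beta_t(cX+(1-c)Y)\ge\min(\beta_t(X),\beta_t(Y))$ for all $X,Y\in L^{bb}_T$ and real $c\in[0,1]$; 2. $z_d=\operatorname{ess\,inf}_X\beta_t(X)$ and $z_u=\operatorname{ess\,sup}_X\beta_t(X)$ are non-random (possibly infinite) and $z_d<z_u$; 3. $X\ge Y$ implies $\beta_t(X)\ge\beta_t(Y)$; and for every real $c>0$, $\beta_t(X+c)>\beta_t(X)$ on $\{\beta_t(X)<z_u\}\cap\{\beta_t(X+c)>z_d\}$; 4. if $X_n\uparrow X$ with $X_n,X\in L^{bb}_T$, then $\beta_t(X_n)\to\beta_t(X)$; 5. $I_B\beta_t(X)=I_B\beta_t(XI_B)$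 for all $B\in\mathcal F_t$; 6. for every real $z\in(z_d,z_u)$ there is $x_z\in\mathbb R$ such that every $\xi\in L^{bb}_t$ with $\beta_t(\xi)\ge z$ satisfies $\xi\ge x_z$. Let $\beta_t$ be a CPM. For $z\in(z_d,z_u)$ real, the induced risk measure is $$\rho^z_t(X)=\operatorname{ess\,inf}\{\xi\in L^{bb}_t : \beta_t(X+\xi)\ge z\},\qquad X\in L^{bb}_T.$$ Let $\mathcal Q$ be the set of probability measures $Q\ll P$ on $(\Omega,\mathcal F_T)$ with $Q|_{\mathcal F_t}=P|_{\mathcal F_t}$, write $E^Q_t[\cdot]=E^Q[\cdot\mid\mathcal F_t]$, and let $$\alpha_t(Q)=\operatorname{ess\,sup}_{Z\in L^\infty_T}\bigl(E^Q_t[-Z]-\rho^z_t(Z)\bigr),\qquad Q\in\mathcal Q.$$ Then, for every real $z\in(z_d,z_u)$: (a) for every $X\in L^\infty_T$, $$\rho^z_t(X)=\operatorname*{ess\,max}_{Q\in\mathcal Q}\bigl(E^Q_t[-X]-\alpha_t(Q)\bigr),$$ that is, $E^Q_t[-X]-\alpha_t(Q)\le\rho^z_t(X)$ a.s. for every $Q\in\mathcal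 Q$, with equality a.s. for some $Q\in\mathcal Q$; (b) $\rho^z_t$ is continuous from above on $L^\infty_T$: if $X_n,X\in L^\infty_T$ and $X_n\downarrow X$ a.s., then $\rho^z_t(X_n)\uparrow\rho^z_t(X)$ a.s.; (c) for every $X\in L^{bb}_T$ there is a sequence $(Q_n)$ in $\mathcal Q$ such that, a.s., $$\rho^z_t(X)=\lim_{n\to\infty}\bigl(E^{Q_n}_t[-(X\wedge n)]-\alpha_t(Q_n)\bigr).$$ -/

import Mathlib

open MeasureTheory Filter Topology
open scoped ENNReal

namespace CondPerf

/-- `X` is (a version of) an element of `L^bb(m)`: an `m`-measurable random variable that is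
essentially bounded from below by a real constant and may take the value `+∞`. -/
def IsLbb {Ω : Type*} (m : MeasurableSpace Ω) {mΩ : MeasurableSpace Ω} (P : Measure Ω)
    (X : Ω → EReal) : Prop :=
  Measurable[m] X ∧ ∃ c : ℝ, ∀ᵐ ω ∂P, (c : EReal) ≤ X ω

/-- `X` is (a version of) an element of `L^∞(m)`: a real-valued `m`-measurable random variable
that is essentially bounded. -/
def IsLinf {Ω : Type*} (m : MeasurableSpace Ω) {mΩ : MeasurableSpace Ω} (P : Measure Ω)
    (X : Ω → ℝ) : Prop :=
  Measurable[m] X ∧ ∃ c : ℝ, ∀ᵐ ω ∂P, |X ω| ≤ c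

/-- `η` is an (`m`-measurable version of the) essential supremum of the family `S` of random
variables: the least random variable that dominates every member of `S` almost surely. -/
structure IsEssSup {Ω : Type*} (m : MeasurableSpace Ω) {mΩ : MeasurableSpace Ω} (P : Measure Ω)
    (S : Set (Ω → EReal)) (η : Ω → EReal) : Prop where
  measurable : Measurable[m] η
  le : ∀ ξ ∈ S, ξ ≤ᵐ[P] η
  least : ∀ ζ : Ω → EReal, Measurable ζ → (∀ ξ ∈ S, ξ ≤ᵐ[P] ζ) → η ≤ᵐ[P] ζ

/-- `η` is an (`m`-measurable version of the) essential infimum of the family `S`. -/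
structure IsEssInf {Ω : Type*} (m : MeasurableSpace Ω) {mΩ : MeasurableSpace Ω} (P : Measure Ω)
    (S : Set (Ω → EReal)) (η : Ω → EReal) : Prop where
  measurable : Measurable[m] η
  le : ∀ ξ ∈ S, η ≤ᵐ[P] ξ
  greatest : ∀ ζ : Ω → EReal, Measurable ζ → (∀ ξ ∈ S, ζ ≤ᵐ[P] ξ) → ζ ≤ᵐ[P] η

/-- `η` is the essential maximum of the family `S`: it dominates every member of `S` almost
surely, and it is attained by a member of `S`. -/
def IsEssMax {Ω : Type*} {mΩ : MeasurableSpace Ω} (P : Measure Ω)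
    (S : Set (Ω → EReal)) (η : Ω → EReal) : Prop :=
  (∀ ξ ∈ S, ξ ≤ᵐ[P] η) ∧ ∃ ξ ∈ S, ξ =ᵐ[P] η

/-- Every family of `m`-measurable extended real random variables on a probability space has an
`m`-measurable essential supremum. -/
theorem exists_isEssSup {Ω : Type*} {m : MeasurableSpace Ω} {mΩ : MeasurableSpace Ω}
    (hm : m ≤ mΩ) (P : Measure Ω) [IsProbabilityMeasure P] (S : Set (Ω → EReal))
    (hS : ∀ ξ ∈ S, Measurable[m] ξ) : ∃ η, IsEssSup m P S η := by
  let φ : EReal → ℝ≥0∞ := fun x => (ENNReal.orderIsoIicOneBirational (EReal.expOrderIso x)).1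
  have hφs : StrictMono φ := fun x y h => by
    have : ENNReal.orderIsoIicOneBirational (EReal.expOrderIso x)
        < ENNReal.orderIsoIicOneBirational (EReal.expOrderIso y) := by simpa using h
    exact this
  have hφm : Measurable φ := hφs.monotone.measurable
  have hφ1 : ∀ x, φ x ≤ 1 := fun x =>
    (ENNReal.orderIsoIicOneBirational (EReal.expOrderIso x)).2
  let g : Set (Ω → EReal) → Ω → EReal := fun C ω => ⨆ ξ ∈ C, ξ ω
  have hgm : ∀ C : Set (Ω → EReal), C ⊆ S → C.Countable → Measurable[m] (g C) := by
    intro C hC hc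
    exact Measurable.biSup C hc (fun ξ hξ => hS ξ (hC hξ))
  have hgmono : ∀ C D : Set (Ω → EReal), C ⊆ D → g C ≤ g D := fun C D h ω =>
    biSup_mono (fun i hi => h hi)
  let J : Set (Ω → EReal) → ℝ≥0∞ := fun C => ∫⁻ ω, φ (g C ω) ∂P
  have hJmono : ∀ C D, C ⊆ D → J C ≤ J D := fun C D h =>
    lintegral_mono (fun ω => hφs.monotone (hgmono C D h ω))
  have hJ1 : ∀ C, J C ≠ ∞ := by
    intro C
    have h1 : J C ≤ ∫⁻ _, 1 ∂P := lintegral_mono (fun ω => hφ1 _)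
    rw [lintegral_one, measure_univ] at h1
    exact (h1.trans_lt ENNReal.one_lt_top).ne
  obtain ⟨u, -, hu, huT⟩ := exists_seq_tendsto_sSup
    (S := J '' {C | C ⊆ S ∧ C.Countable}) ⟨J ∅, ∅, ⟨Set.empty_subset _, Set.countable_empty⟩, rfl⟩
    (OrderTop.bddAbove _)
  choose C hC hCu using huT
  let D : Set (Ω → EReal) := ⋃ n, C n
  have hDS : D ⊆ S := Set.iUnion_subset fun n => (hC n).1
  have hDc : D.Countable := Set.countable_iUnion fun n => (hC n).2
  have hDmax : ∀ E, E ⊆ S → E.Countable → J E ≤ J D := by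
    intro E hE hEc
    refine (le_sSup (show J E ∈ J '' {C | C ⊆ S ∧ C.Countable} from
      ⟨E, ⟨hE, hEc⟩, rfl⟩)).trans ?_
    refine le_of_tendsto' hu (fun n => ?_)
    rw [← hCu n]
    exact hJmono _ _ (Set.subset_iUnion C n)
  refine ⟨g D, hgm D hDS hDc, ?_, ?_⟩
  · intro ξ hξ
    have hE : insert ξ D ⊆ S := Set.insert_subset hξ hDS
    have hEc : (insert ξ D).Countable := hDc.insert ξ
    have hle := hgmono D (insert ξ D) (Set.subset_insert _ _)
    have hae := ae_eq_of_ae_le_of_lintegral_le (μ := P)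
      (f := fun ω => φ (g D ω)) (g := fun ω => φ (g (insert ξ D) ω))
      (Eventually.of_forall fun ω => hφs.monotone (hle ω)) (hJ1 D)
      (hφm.comp ((hgm _ hE hEc).mono hm le_rfl)).aemeasurable (hDmax _ hE hEc)
    filter_upwards [hae] with ω hω
    rw [hφs.injective hω]
    exact le_biSup (fun ξ : Ω → EReal => ξ ω) (Set.mem_insert ξ D)
  · intro ζ _ h
    have : ∀ᵐ ω ∂P, ∀ ξ ∈ D, ξ ω ≤ ζ ω := (ae_ball_iff hDc).2 fun ξ hξ => h ξ (hDS hξ)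
    filter_upwards [this] with ω hω
    exact iSup₂_le hω

/-- Every family of `m`-measurable extended real random variables on a probability space has an
`m`-measurable essential infimum. -/
theorem exists_isEssInf {Ω : Type*} {m : MeasurableSpace Ω} {mΩ : MeasurableSpace Ω}
    (hm : m ≤ mΩ) (P : Measure Ω) [IsProbabilityMeasure P] (S : Set (Ω → EReal))
    (hS : ∀ ξ ∈ S, Measurable[m] ξ) : ∃ η, IsEssInf m P S η := by
  have hneg : Measurable (fun x : EReal => -x) := continuous_neg.measurable
  obtain ⟨η, h1, h2, h3⟩ := exists_isEssSup hm P {ξ | (fun ω => -ξ ω) ∈ S} (fun ξ hξ => by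
    have := hneg.comp (hS _ hξ)
    simpa [Function.comp_def] using this)
  refine ⟨fun ω => -η ω, hneg.comp h1, ?_, ?_⟩
  · intro ξ hξ
    filter_upwards [h2 (fun ω => -ξ ω) (by simpa using hξ)] with ω hω
    exact EReal.neg_le.1 hω
  · intro ζ hζ h
    have := h3 (fun ω => -ζ ω) (hneg.comp hζ) (fun ξ hξ => by
      filter_upwards [h _ hξ] with ω hω
      exact EReal.le_neg_of_le_neg hω)
    filter_upwards [this] with ω hω
    exact EReal.le_neg_of_le_neg hω

open Classical in
/-- The essential supremum of a family of `m`-measurable random variables (a chosen version). -/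
noncomputable def essSupFam {Ω : Type*} (m : MeasurableSpace Ω) {mΩ : MeasurableSpace Ω}
    (P : Measure Ω) (S : Set (Ω → EReal)) : Ω → EReal :=
  if h : ∃ η, IsEssSup m P S η then h.choose else 0

open Classical in
/-- The essential infimum of a family of `m`-measurable random variables (a chosen version). -/
noncomputable def essInfFam {Ω : Type*} (m : MeasurableSpace Ω) {mΩ : MeasurableSpace Ω}
    (P : Measure Ω) (S : Set (Ω → EReal)) : Ω → EReal :=
  if h : ∃ η, IsEssInf m P S η then h.choose else 0

theorem isEssSup_essSupFam {Ω : Type*} {m : MeasurableSpace Ω} {mΩ : MeasurableSpace Ω}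
    (hm : m ≤ mΩ) (P : Measure Ω) [IsProbabilityMeasure P] (S : Set (Ω → EReal))
    (hS : ∀ ξ ∈ S, Measurable[m] ξ) : IsEssSup m P S (essSupFam m P S) := by
  have h := exists_isEssSup hm P S hS
  rw [essSupFam, dif_pos h]
  exact h.choose_spec

theorem isEssInf_essInfFam {Ω : Type*} {m : MeasurableSpace Ω} {mΩ : MeasurableSpace Ω}
    (hm : m ≤ mΩ) (P : Measure Ω) [IsProbabilityMeasure P] (S : Set (Ω → EReal))
    (hS : ∀ ξ ∈ S, Measurable[m] ξ) : IsEssInf m P S (essInfFam m P S) := by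
  have h := exists_isEssInf hm P S hS
  rw [essInfFam, dif_pos h]
  exact h.choose_spec

/-- `β` is a performance measure conditional to `m` on the probability space `(Ω, mΩ, P)`, with
essential infimum `zd` and essential supremum `zu` over all positions. Positions are represented
by functions; by `mono`, `β` respects almost sure equality. In products the convention
`0 * ∞ = 0` is in force, and `B.indicator X` is `X` on `B` and `0` off `B`. -/
structure IsCPM {Ω : Type*} (m : MeasurableSpace Ω) {mΩ : MeasurableSpace Ω} (P : Measure Ω)
    (β : (Ω → EReal) → Ω → EReal) (zd zu : EReal) : Prop where
  maps : ∀ X, IsLbb mΩ P X → IsLbb m P (β X)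
  quasiconcave : ∀ c : ℝ, 0 ≤ c → c ≤ 1 → ∀ X Y, IsLbb mΩ P X → IsLbb mΩ P Y →
    ∀ᵐ ω ∂P, min (β X ω) (β Y ω) ≤
      β (fun ω' => (c : EReal) * X ω' + ((1 - c : ℝ) : EReal) * Y ω') ω
  essInf_eq : IsEssInf m P {η | ∃ X, IsLbb mΩ P X ∧ η = β X} (fun _ => zd)
  essSup_eq : IsEssSup m P {η | ∃ X, IsLbb mΩ P X ∧ η = β X} (fun _ => zu)
  zd_lt_zu : zd < zu
  mono : ∀ X Y, IsLbb mΩ P X → IsLbb mΩ P Y → Y ≤ᵐ[P] X → β Y ≤ᵐ[P] β X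
  strictMono_shift : ∀ X, IsLbb mΩ P X → ∀ c : ℝ, 0 < c →
    ∀ᵐ ω ∂P, β X ω < zu → zd < β (fun ω' => X ω' + (c : EReal)) ω →
      β X ω < β (fun ω' => X ω' + (c : EReal)) ω
  continuous_below : ∀ (X : ℕ → Ω → EReal) (Y : Ω → EReal),
    (∀ n, IsLbb mΩ P (X n)) → IsLbb mΩ P Y →
    (∀ᵐ ω ∂P, Monotone (fun n => X n ω) ∧ Tendsto (fun n => X n ω) atTop (𝓝 (Y ω))) →
    ∀ᵐ ω ∂P, Tendsto (fun n => β (X n) ω) atTop (𝓝 (β Y ω))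
  locality : ∀ X, IsLbb mΩ P X → ∀ B : Set Ω, MeasurableSet[m] B →
    B.indicator (β X) =ᵐ[P] B.indicator (β (B.indicator X))
  bounded_level : ∀ z : ℝ, zd < z → z < zu → ∃ x : ℝ, ∀ ξ, IsLbb m P ξ →
    (∀ᵐ ω ∂P, (z : EReal) ≤ β ξ ω) → ∀ᵐ ω ∂P, (x : EReal) ≤ ξ ω

/-- The risk measure induced by `β` at level `z`:
`ρ(X) = ess inf {ξ ∈ L^bb(m) | β(X + ξ) ≥ z}`. -/
noncomputable def inducedRisk {Ω : Type*} (m : MeasurableSpace Ω) {mΩ : MeasurableSpace Ω}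
    (P : Measure Ω) (β : (Ω → EReal) → Ω → EReal) (z : ℝ) (X : Ω → EReal) : Ω → EReal :=
  essInfFam m P {ξ | IsLbb m P ξ ∧ ∀ᵐ ω ∂P, (z : EReal) ≤ β (fun ω' => X ω' + ξ ω') ω}

/-- The probability measures `Q ≪ P` on `(Ω, mΩ)` that coincide with `P` on `m`. -/
def dualMeasures {Ω : Type*} (m : MeasurableSpace Ω) {mΩ : MeasurableSpace Ω}
    (P : Measure Ω) : Set (Measure Ω) :=
  {Q | IsProbabilityMeasure Q ∧ Q ≪ P ∧ ∀ B, MeasurableSet[m] B → Q B = P B}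

/-- The conditional expectation `E^Q[-X | m]`, as an extended real random variable. -/
noncomputable def condLoss {Ω : Type*} (m : MeasurableSpace Ω) {mΩ : MeasurableSpace Ω}
    (Q : Measure Ω) (X : Ω → ℝ) (ω : Ω) : EReal :=
  (((Q[(fun ω' => -X ω') | m]) ω : ℝ) : EReal)

/-- The minimal penalty `α(Q) = ess sup {E^Q[-Z | m] - ρ(Z) | Z ∈ L^∞(mΩ)}` of `ρ`. -/
noncomputable def minPenalty {Ω : Type*} (m : MeasurableSpace Ω) {mΩ : MeasurableSpace Ω}
    (P : Measure Ω) (ρ : (Ω → EReal) → Ω → EReal) (Q : Measure Ω) : Ω → EReal :=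
  essSupFam m P {η | ∃ Z : Ω → ℝ, IsLinf mΩ P Z ∧
    η = fun ω => condLoss m Q Z ω - ρ (fun ω' => (Z ω' : EReal)) ω}

/-- `ρ`, restricted to `L^∞(mΩ)`, is continuous from above: if `X n ↓ Y` almost surely in
`L^∞(mΩ)`, then `ρ(X n) ↑ ρ(Y)` almost surely. -/
def ContinuousFromAbove {Ω : Type*} {mΩ : MeasurableSpace Ω} (P : Measure Ω)
    (ρ : (Ω → EReal) → Ω → EReal) : Prop :=
  ∀ (X : ℕ → Ω → ℝ) (Y : Ω → ℝ), (∀ n, IsLinf mΩ P (X n)) → IsLinf mΩ P Y →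
    (∀ᵐ ω ∂P, Antitone (fun n => X n ω) ∧ Tendsto (fun n => X n ω) atTop (𝓝 (Y ω))) →
    ∀ᵐ ω ∂P, Monotone (fun n => ρ (fun ω' => (X n ω' : EReal)) ω) ∧
      Tendsto (fun n => ρ (fun ω' => (X n ω' : EReal)) ω) atTop
        (𝓝 (ρ (fun ω' => (Y ω' : EReal)) ω))

end CondPerf

/-! On bounded positions the induced risk measure ρ is a finite, antitone, cash-invariant, convex
map that is continuous from below; the rest is convex duality for such maps.

Two facts link ρ to β. If ξ is accepted for X only at some ω, then ρ(X) ≤ ξ at those ω, because ξ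
may be replaced by +∞ elsewhere (`inducedRisk_le_of_accepted`). Conversely ρ(X) + ε is accepted for
every ε > 0 (`accepted_inducedRisk_add`). Convexity of ρ then follows from quasiconcavity of β, and
continuity from below from that of β together with strict monotonicity under shifts.

For the dual side, fix a bounded X. The functional Y ↦ E[ρ(Y) − ρ(X)] is finite and convex, so
Hahn–Banach gives an algebraic linear support −L at X. Monotonicity makes L positive, cash
invariance makes it agree with P on the small σ-algebra, and continuity from below makes it
countably additive, so L is the expectation under some Q in 𝒬. Testing on events B of the small
σ-algebra turns the integrated inequality into ρ(X) − ρ(Y) ≤ E^Q_t[−X] − E^Q_t[−Y]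
(`exists_sub_le_condExp`), so the supremum defining α(Q) is attained at X. This is (a). The
integrated inequality at the limit of a decreasing sequence gives (b), and (a) at X ∧ n with
continuity from below gives (c). -/

namespace CondPerf

/-! ### Induced risk on positions bounded from below: monotonicity, continuity from below,
finiteness. -/

section Performance

variable {Ω : Type*} {m mΩ : MeasurableSpace Ω} {P : Measure Ω}

theorem IsLbb.mono_sigma {X : Ω → EReal} (hm : m ≤ mΩ) (hX : IsLbb m P X) : IsLbb mΩ P X :=
  ⟨hX.1.mono hm le_rfl, hX.2⟩

theorem IsLbb.top : IsLbb m P (fun _ : Ω => (⊤ : EReal)) :=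
  ⟨measurable_const, 0, by simp⟩

theorem isLbb_const (c : ℝ) : IsLbb m P (fun _ : Ω => (c : EReal)) :=
  ⟨measurable_const, c, by simp⟩

theorem IsLbb.ne_bot {X : Ω → EReal} (hX : IsLbb m P X) : ∀ᵐ ω ∂P, X ω ≠ ⊥ := by
  obtain ⟨c, hc⟩ := hX.2
  filter_upwards [hc] with ω hω h
  rw [h] at hω
  exact absurd (le_bot_iff.1 hω) (EReal.coe_ne_bot c)

theorem IsLbb.add {X Y : Ω → EReal} (hX : IsLbb m P X) (hY : IsLbb m P Y) :
    IsLbb m P (fun ω => X ω + Y ω) := by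
  obtain ⟨c, hc⟩ := hX.2
  obtain ⟨d, hd⟩ := hY.2
  refine ⟨hX.1.add hY.1, c + d, ?_⟩
  filter_upwards [hc, hd] with ω h1 h2
  rw [EReal.coe_add]
  exact add_le_add h1 h2

theorem IsLbb.piecewise {X Y : Ω → EReal} (hX : IsLbb m P X) (hY : IsLbb m P Y) {B : Set Ω}
    [DecidablePred (· ∈ B)] (hB : MeasurableSet[m] B) : IsLbb m P (B.piecewise X Y) := by
  obtain ⟨c, hc⟩ := hX.2
  obtain ⟨d, hd⟩ := hY.2
  refine ⟨Measurable.piecewise hB hX.1 hY.1, min c d, ?_⟩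
  filter_upwards [hc, hd] with ω h1 h2
  by_cases h : ω ∈ B
  · rw [Set.piecewise_eq_of_mem _ _ _ h]
    exact le_trans (by exact_mod_cast min_le_left c d) h1
  · rw [Set.piecewise_eq_of_notMem _ _ _ h]
    exact le_trans (by exact_mod_cast min_le_right c d) h2

theorem IsLbb.indicator {X : Ω → EReal} (hX : IsLbb m P X) {B : Set Ω}
    (hB : MeasurableSet[m] B) : IsLbb m P (B.indicator X) := by
  classical
  rw [← Set.piecewise_eq_indicator]
  exact hX.piecewise (isLbb_const 0) hB

theorem IsLinf.isLbb {X : Ω → ℝ} (hX : IsLinf m P X) : IsLbb m P (fun ω => (X ω : EReal)) := by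
  obtain ⟨c, hc⟩ := hX.2
  refine ⟨hX.1.coe_real_ereal, -c, ?_⟩
  filter_upwards [hc] with ω hω
  exact_mod_cast (abs_le.1 hω).1

theorem IsLbb.isLinf_toReal_min {X : Ω → EReal} (hX : IsLbb mΩ P X) (n : ℝ) :
    IsLinf mΩ P (fun ω => (min (X ω) (n : EReal)).toReal) ∧
    ∀ᵐ ω ∂P, (((min (X ω) (n : EReal)).toReal : ℝ) : EReal) = min (X ω) (n : EReal) := by
  obtain ⟨c, hc⟩ := hX.2
  have hco : ∀ᵐ ω ∂P, (((min (X ω) (n : EReal)).toReal : ℝ) : EReal) = min (X ω) (n : EReal) := by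
    filter_upwards [hX.ne_bot] with ω hω
    refine EReal.coe_toReal ((min_le_right _ _).trans_lt (EReal.coe_lt_top n)).ne ?_
    exact (lt_min (bot_lt_iff_ne_bot.2 hω) (EReal.bot_lt_coe n)).ne'
  refine ⟨⟨(hX.1.min measurable_const).ereal_toReal, max n (-(min c n)), ?_⟩, hco⟩
  filter_upwards [hc, hco] with ω h1 h2
  have h3 : (((min (X ω) (n : EReal)).toReal : ℝ) : EReal) ≤ n := h2.le.trans (min_le_right _ _)
  have h4 : ((min c n : ℝ) : EReal) ≤ (((min (X ω) (n : EReal)).toReal : ℝ) : EReal) := by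
    rw [h2, EReal.coe_strictMono.monotone.map_min]
    exact min_le_min_right _ h1
  rw [EReal.coe_le_coe_iff] at h3 h4
  rw [abs_le]
  exact ⟨by linarith [le_max_right n (-(min c n))], h3.trans (le_max_left _ _)⟩

variable {β : (Ω → EReal) → Ω → EReal} {zd zu : EReal} {z : ℝ}

/-- By locality, `β X` on `B` depends only on `B.indicator X`, and the truncated positions are
ordered everywhere. -/
theorem IsCPM.local_mono (hβ : IsCPM m P β zd zu) (hm : m ≤ mΩ) {X Y : Ω → EReal}
    (hX : IsLbb mΩ P X) (hY : IsLbb mΩ P Y) {B : Set Ω} (hB : MeasurableSet[m] B)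
    (h : ∀ᵐ ω ∂P, ω ∈ B → X ω ≤ Y ω) : ∀ᵐ ω ∂P, ω ∈ B → β X ω ≤ β Y ω := by
  have h1 := hβ.mono _ _ (hY.indicator (hm _ hB)) (hX.indicator (hm _ hB)) (by
    filter_upwards [h] with ω hω
    by_cases hb : ω ∈ B <;> simp [hb, hω])
  filter_upwards [h1, hβ.locality X hX B hB, hβ.locality Y hY B hB] with ω h1 h2 h3 hb
  rw [Set.indicator_of_mem hb, Set.indicator_of_mem hb] at h2 h3
  rwa [h2, h3]

theorem IsCPM.top_eq (hβ : IsCPM m P β zd zu) (hm : m ≤ mΩ) :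
    ∀ᵐ ω ∂P, β (fun _ => ⊤) ω = zu := by
  have htop : IsLbb mΩ P (fun _ : Ω => (⊤ : EReal)) := IsLbb.top
  have h1 := hβ.essSup_eq.le _ ⟨_, htop, rfl⟩
  have h2 := hβ.essSup_eq.least _ ((hβ.maps _ htop).1.mono hm le_rfl) (by
    rintro _ ⟨X, hX, rfl⟩
    exact hβ.mono _ _ htop hX (Eventually.of_forall fun _ => le_top))
  filter_upwards [h1, h2] with ω h1 h2
  exact le_antisymm h1 h2

/-- Either `β X ω < zu` and the strict shift axiom applies, its other condition following from `zd <
z`, or `β X ω ≥ zu > z` already. -/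
theorem IsCPM.lt_add_const (hβ : IsCPM m P β zd zu) (hzd : zd < (z : EReal))
    (hzu : (z : EReal) < zu) {X : Ω → EReal} (hX : IsLbb mΩ P X) {ε : ℝ} (hε : 0 < ε) :
    ∀ᵐ ω ∂P, (z : EReal) ≤ β X ω → (z : EReal) < β (fun ω' => X ω' + (ε : EReal)) ω := by
  have hle := hβ.mono _ _ (hX.add (isLbb_const ε)) hX (Eventually.of_forall fun ω => by
    have : (0 : EReal) ≤ ε := by exact_mod_cast hε.le
    simpa using add_le_add_right this (X ω))
  filter_upwards [hβ.strictMono_shift X hX ε hε, hle] with ω h1 h2 h3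
  rcases lt_or_ge (β X ω) zu with h | h
  · exact h3.trans_lt (h1 h (hzd.trans_le (h3.trans h2)))
  · exact hzu.trans_le (h.trans h2)

variable [IsProbabilityMeasure P]

theorem isEssInf_inducedRisk (hm : m ≤ mΩ) (β : (Ω → EReal) → Ω → EReal) (z : ℝ)
    (X : Ω → EReal) :
    IsEssInf m P {ξ | IsLbb m P ξ ∧ ∀ᵐ ω ∂P, (z : EReal) ≤ β (fun ω' => X ω' + ξ ω') ω}
      (inducedRisk m P β z X) :=
  isEssInf_essInfFam hm P _ fun _ hξ => hξ.1.1

theorem IsCPM.inducedRisk_anti (hβ : IsCPM m P β zd zu) (hm : m ≤ mΩ) {X Y : Ω → EReal}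
    (hX : IsLbb mΩ P X) (hY : IsLbb mΩ P Y) (h : X ≤ᵐ[P] Y) :
    inducedRisk m P β z Y ≤ᵐ[P] inducedRisk m P β z X := by
  refine (isEssInf_inducedRisk hm β z X).greatest _
    ((isEssInf_inducedRisk hm β z Y).measurable.mono hm le_rfl) ?_
  rintro ξ ⟨hξ, hz⟩
  refine (isEssInf_inducedRisk hm β z Y).le _ ⟨hξ, ?_⟩
  have := hβ.mono _ _ (hY.add (hξ.mono_sigma hm)) (hX.add (hξ.mono_sigma hm)) (by
    filter_upwards [h] with ω hω
    exact add_le_add_left hω _)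
  filter_upwards [hz, this] with ω h1 h2
  exact h1.trans h2

/-- Acceptance is needed only at the given `ω`: off the `m`-measurable event of acceptance, `ξ` is
replaced by `⊤`, which is accepted there since `β ⊤ = zu > z`. -/
theorem IsCPM.inducedRisk_le_of_accepted (hβ : IsCPM m P β zd zu) (hm : m ≤ mΩ)
    (hzu : (z : EReal) < zu) {X ξ : Ω → EReal} (hX : IsLbb mΩ P X) (hξ : IsLbb m P ξ) :
    ∀ᵐ ω ∂P, (z : EReal) ≤ β (fun ω' => X ω' + ξ ω') ω → inducedRisk m P β z X ω ≤ ξ ω := by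
  classical
  set B : Set Ω := {ω | (z : EReal) ≤ β (fun ω' => X ω' + ξ ω') ω}
  have hXξ := hX.add (hξ.mono_sigma hm)
  have hB : MeasurableSet[m] B := (hβ.maps _ hXξ).1 measurableSet_Ici
  have hξ' : IsLbb m P (B.piecewise ξ (fun _ => ⊤)) := hξ.piecewise IsLbb.top hB
  have hXξ' := hX.add (hξ'.mono_sigma hm)
  have h1 := hβ.local_mono hm hXξ hXξ' hB (Eventually.of_forall fun ω hω => by simp [hω])
  have h2 := hβ.local_mono hm IsLbb.top hXξ' hB.compl (by
    filter_upwards [hX.ne_bot] with ω hb hω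
    rw [Set.piecewise_eq_of_notMem _ _ _ hω, EReal.add_top_of_ne_bot hb])
  have h3 := (isEssInf_inducedRisk hm β z X).le _ (show _ ∈ _ from ⟨hξ', by
    filter_upwards [h1, h2, hβ.top_eq hm] with ω h1 h2 h3
    by_cases hω : ω ∈ B
    · exact le_trans hω (h1 hω)
    · exact hzu.le.trans (h3 ▸ h2 hω)⟩)
  filter_upwards [h3] with ω h3 hω
  rwa [Set.piecewise_eq_of_mem _ _ _ (show ω ∈ B from hω)] at h3

/-- If `ξ` is accepted for `Y`, then `ξ + ε` is accepted strictly, so by continuity of `β` it is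
accepted at `ω` for some `X n`. Hence the infimum of the risks is at most `ξ + ε`, and `ε ↓ 0` along
`1 / (k + 1)`. -/
theorem IsCPM.inducedRisk_tendsto_of_monotone (hβ : IsCPM m P β zd zu) (hm : m ≤ mΩ)
    (hzd : zd < (z : EReal)) (hzu : (z : EReal) < zu) {X : ℕ → Ω → EReal} {Y : Ω → EReal}
    (hX : ∀ n, IsLbb mΩ P (X n)) (hY : IsLbb mΩ P Y)
    (h : ∀ᵐ ω ∂P, Monotone (fun n => X n ω) ∧ Tendsto (fun n => X n ω) atTop (𝓝 (Y ω))) :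
    ∀ᵐ ω ∂P, Tendsto (fun n => inducedRisk m P β z (X n) ω) atTop
      (𝓝 (inducedRisk m P β z Y ω)) := by
  have hmeas : ∀ n, Measurable[m] (inducedRisk m P β z (X n)) := fun n =>
    (isEssInf_inducedRisk hm β z (X n)).measurable
  have hanti : ∀ n, inducedRisk m P β z (X (n + 1)) ≤ᵐ[P] inducedRisk m P β z (X n) := fun n =>
    hβ.inducedRisk_anti hm (hX n) (hX (n + 1)) (by
      filter_upwards [h] with ω hω using hω.1 n.le_succ)
  have hge : ∀ n, inducedRisk m P β z Y ≤ᵐ[P] inducedRisk m P β z (X n) := fun n =>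
    hβ.inducedRisk_anti hm (hX n) hY (by
      filter_upwards [h] with ω hω using hω.1.ge_of_tendsto hω.2 n)
  have hle : (fun ω => ⨅ n, inducedRisk m P β z (X n) ω) ≤ᵐ[P] inducedRisk m P β z Y := by
    refine (isEssInf_inducedRisk hm β z Y).greatest _
      (Measurable.iInf fun n => (hmeas n).mono hm le_rfl) ?_
    rintro ξ ⟨hξ, hz⟩
    have hε : ∀ k : ℕ, ∀ᵐ ω ∂P, ⨅ n, inducedRisk m P β z (X n) ω
        ≤ ξ ω + ((1 / ((k : ℝ) + 1) : ℝ) : EReal) := by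
      intro k
      have hε : (0 : ℝ) < 1 / ((k : ℝ) + 1) := by positivity
      set ε : ℝ := 1 / ((k : ℝ) + 1)
      have hξε : IsLbb m P (fun ω => ξ ω + (ε : EReal)) := hξ.add (isLbb_const ε)
      have hlt := hβ.lt_add_const hzd hzu (hY.add (hξ.mono_sigma hm)) hε
      have hcont := hβ.continuous_below (fun n ω => X n ω + (ξ ω + (ε : EReal)))
        (fun ω => Y ω + (ξ ω + (ε : EReal))) (fun n => (hX n).add (hξε.mono_sigma hm))
        (hY.add (hξε.mono_sigma hm)) (by
          filter_upwards [h, hY.ne_bot, hξε.ne_bot] with ω hω h1 h2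
          refine ⟨fun i j hij => add_le_add_left (hω.1 hij) _, ?_⟩
          exact (EReal.continuousAt_add (p := (Y ω, ξ ω + (ε : EReal))) (Or.inr h2)
            (Or.inl h1)).tendsto.comp (hω.2.prodMk_nhds tendsto_const_nhds))
      have hacc := ae_all_iff.2 fun n =>
        hβ.inducedRisk_le_of_accepted hm hzu (hX n) hξε
      filter_upwards [hz, hlt, hcont, hacc] with ω h1 h2 h3 h4
      have h5 := h2 h1
      simp only [add_assoc] at h5
      obtain ⟨n, hn⟩ := (h3.eventually_const_lt h5).exists
      exact (iInf_le _ n).trans (h4 n hn.le)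
    filter_upwards [ae_all_iff.2 hε] with ω hω
    have hlim : Tendsto (fun k : ℕ => ξ ω + ((1 / ((k : ℝ) + 1) : ℝ) : EReal)) atTop
        (𝓝 (ξ ω + ((0 : ℝ) : EReal))) :=
      (EReal.continuousAt_add (p := (ξ ω, ((0 : ℝ) : EReal))) (Or.inr (EReal.coe_ne_bot _))
        (Or.inr (EReal.coe_ne_top _))).tendsto.comp
        (tendsto_const_nhds.prodMk_nhds
          ((continuous_coe_real_ereal.tendsto _).comp tendsto_one_div_add_atTop_nhds_zero_nat))
    simpa using ge_of_tendsto' hlim hω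
  filter_upwards [ae_all_iff.2 hanti, ae_all_iff.2 hge, hle] with ω h1 h2 h3
  rw [le_antisymm (le_iInf h2) h3]
  exact tendsto_atTop_iInf (antitone_nat_of_succ_le h1)

/-- `β (X + n)` tends to `β ⊤ = zu > z`, so at almost every `ω` some constant `n` is accepted. -/
theorem IsCPM.inducedRisk_lt_top (hβ : IsCPM m P β zd zu) (hm : m ≤ mΩ)
    (hzu : (z : EReal) < zu) {X : Ω → EReal} (hX : IsLbb mΩ P X) :
    ∀ᵐ ω ∂P, inducedRisk m P β z X ω < ⊤ := by
  have hcont := hβ.continuous_below (fun n ω => X ω + ((n : ℝ) : EReal)) (fun _ => ⊤)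
    (fun n => hX.add (isLbb_const _)) IsLbb.top (by
      filter_upwards [hX.ne_bot] with ω h1
      refine ⟨fun i j hij => add_le_add_right (by exact_mod_cast hij) _, ?_⟩
      have := (EReal.continuousAt_add (p := (X ω, ⊤)) (Or.inr top_ne_bot)
        (Or.inl h1)).tendsto.comp (tendsto_const_nhds.prodMk_nhds
          (EReal.tendsto_coe_nhds_top_iff.2 tendsto_natCast_atTop_atTop))
      simpa [EReal.add_top_of_ne_bot h1, Function.comp_def] using this)
  have hacc := ae_all_iff.2 fun n : ℕ =>
    hβ.inducedRisk_le_of_accepted hm hzu hX (isLbb_const (P := P) (m := m) (n : ℝ))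
  filter_upwards [hcont, hacc, hβ.top_eq hm] with ω h1 h2 h3
  rw [h3] at h1
  obtain ⟨n, hn⟩ := (h1.eventually_const_lt hzu).exists
  exact (h2 n hn.le).trans_lt (EReal.coe_lt_top _)

/-- If `X ≤ c` and `ξ` is accepted, then `β (c + ξ) ≥ z` with `c + ξ` measurable for `m`, so
`bounded_level` gives `ξ ≥ x - c`. -/
theorem IsCPM.isLbb_inducedRisk (hβ : IsCPM m P β zd zu) (hm : m ≤ mΩ)
    (hzd : zd < (z : EReal)) (hzu : (z : EReal) < zu) {X : Ω → ℝ} (hX : IsLinf mΩ P X) :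
    IsLbb m P (inducedRisk m P β z (fun ω => (X ω : EReal))) := by
  obtain ⟨x, hx⟩ := hβ.bounded_level z hzd hzu
  obtain ⟨c, hc⟩ := hX.2
  refine ⟨(isEssInf_inducedRisk hm β z _).measurable, x - c, ?_⟩
  refine (isEssInf_inducedRisk hm β z _).greatest _ measurable_const ?_
  rintro ξ ⟨hξ, hz⟩
  have hle := hβ.mono _ _ ((isLbb_const c).add (hξ.mono_sigma hm))
    (hX.isLbb.add (hξ.mono_sigma hm)) (by
    filter_upwards [hc] with ω hω
    exact add_le_add_left (by exact_mod_cast (abs_le.1 hω).2) _)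
  have := hx (fun ω => (c : EReal) + ξ ω) ((isLbb_const c).add hξ) (by
    filter_upwards [hz, hle] with ω h1 h2 using h1.trans h2)
  filter_upwards [this] with ω hω
  rw [EReal.coe_sub]
  exact EReal.sub_le_of_le_add' hω

end Performance

/-! ### The induced risk on bounded positions as a conditional convex risk measure. -/

section Bounded

variable {Ω : Type*} {m mΩ : MeasurableSpace Ω} {P : Measure Ω}

theorem isLinf_const (c : ℝ) : IsLinf m P (fun _ => c) :=
  ⟨measurable_const, |c|, by simp⟩

theorem IsLinf.mono_sigma {X : Ω → ℝ} (hm : m ≤ mΩ) (hX : IsLinf m P X) : IsLinf mΩ P X :=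
  ⟨hX.1.mono hm le_rfl, hX.2⟩

theorem IsLinf.add {X Y : Ω → ℝ} (hX : IsLinf m P X) (hY : IsLinf m P Y) :
    IsLinf m P (fun ω => X ω + Y ω) := by
  obtain ⟨c, hc⟩ := hX.2
  obtain ⟨d, hd⟩ := hY.2
  refine ⟨hX.1.add hY.1, c + d, ?_⟩
  filter_upwards [hc, hd] with ω h1 h2
  exact (abs_add_le _ _).trans (add_le_add h1 h2)

theorem IsLinf.const_mul {X : Ω → ℝ} (hX : IsLinf m P X) (a : ℝ) :
    IsLinf m P (fun ω => a * X ω) := by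
  obtain ⟨c, hc⟩ := hX.2
  refine ⟨hX.1.const_mul a, |a| * c, ?_⟩
  filter_upwards [hc] with ω h1
  rw [abs_mul]
  exact mul_le_mul_of_nonneg_left h1 (abs_nonneg a)

theorem IsLinf.neg {X : Ω → ℝ} (hX : IsLinf m P X) : IsLinf m P (fun ω => - X ω) := by
  simpa using hX.const_mul (-1)

theorem IsLinf.sub {X Y : Ω → ℝ} (hX : IsLinf m P X) (hY : IsLinf m P Y) :
    IsLinf m P (fun ω => X ω - Y ω) := by
  simpa [sub_eq_add_neg] using hX.add hY.neg

theorem IsLinf.indicator {X : Ω → ℝ} (hX : IsLinf m P X) {B : Set Ω} (hB : MeasurableSet[m] B) :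
    IsLinf m P (B.indicator X) := by
  obtain ⟨c, hc⟩ := hX.2
  refine ⟨hX.1.indicator hB, c, ?_⟩
  filter_upwards [hc] with ω h1
  by_cases h : ω ∈ B
  · simpa [h]
  · simpa [h] using (abs_nonneg _).trans h1

theorem isLinf_indicator_one {B : Set Ω} (hB : MeasurableSet[m] B) :
    IsLinf m P (B.indicator (fun _ => (1 : ℝ))) :=
  (isLinf_const 1).indicator hB

theorem IsLinf.integrable {X : Ω → ℝ} (hX : IsLinf mΩ P X)
    {Q : Measure Ω} [IsFiniteMeasure Q] (hQ : Q ≪ P) : Integrable X Q := by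
  obtain ⟨c, hc⟩ := hX.2
  exact Integrable.of_bound hX.1.aestronglyMeasurable c
    (by filter_upwards [hQ.ae_le hc] with ω hω using hω)

/-- The vector space of essentially bounded random variables. -/
def linf (P : Measure Ω) : Submodule ℝ (Ω → ℝ) where
  carrier := {X | IsLinf mΩ P X}
  add_mem' := fun hX hY => IsLinf.add hX hY
  zero_mem' := isLinf_const 0
  smul_mem' := fun a _ hX => IsLinf.const_mul hX a

/-- A conditional convex risk measure on the essentially bounded random variables that is
continuous from below. -/
structure IsCondRisk (m : MeasurableSpace Ω) {mΩ : MeasurableSpace Ω} (P : Measure Ω)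
    (r : (Ω → ℝ) → Ω → ℝ) : Prop where
  measurable : ∀ X, IsLinf mΩ P X → Measurable[m] (r X)
  anti : ∀ X Y, IsLinf mΩ P X → IsLinf mΩ P Y → X ≤ᵐ[P] Y → r Y ≤ᵐ[P] r X
  add_le : ∀ X η, IsLinf mΩ P X → IsLinf m P η →
    ∀ᵐ ω ∂P, r (fun ω' => X ω' + η ω') ω ≤ r X ω - η ω
  convex : ∀ X Y, IsLinf mΩ P X → IsLinf mΩ P Y → ∀ a b : ℝ, 0 ≤ a → 0 ≤ b → a + b = 1 →
    ∀ᵐ ω ∂P, r (fun ω' => a * X ω' + b * Y ω') ω ≤ a * r X ω + b * r Y ω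
  continuous_below : ∀ (X : ℕ → Ω → ℝ) (Y : Ω → ℝ), (∀ n, IsLinf mΩ P (X n)) → IsLinf mΩ P Y →
    (∀ᵐ ω ∂P, Monotone (fun n => X n ω) ∧ Tendsto (fun n => X n ω) atTop (𝓝 (Y ω))) →
    ∀ᵐ ω ∂P, Tendsto (fun n => r (X n) ω) atTop (𝓝 (r Y ω))

variable {β : (Ω → EReal) → Ω → EReal} {zd zu : EReal} {z : ℝ} [IsProbabilityMeasure P]

theorem IsCPM.coe_toReal_inducedRisk (hβ : IsCPM m P β zd zu) (hm : m ≤ mΩ)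
    (hzd : zd < (z : EReal)) (hzu : (z : EReal) < zu) {X : Ω → ℝ} (hX : IsLinf mΩ P X) :
    ∀ᵐ ω ∂P, (((inducedRisk m P β z (fun ω' => (X ω' : EReal)) ω).toReal : ℝ) : EReal)
      = inducedRisk m P β z (fun ω' => (X ω' : EReal)) ω := by
  filter_upwards [hβ.inducedRisk_lt_top hm hzu hX.isLbb,
    (hβ.isLbb_inducedRisk hm hzd hzu hX).ne_bot] with ω h1 h2
  exact EReal.coe_toReal h1.ne h2

/-- Let `B` be the event where `ρ + ε` fails. By local monotonicity no accepted `ξ` lies below `ρ +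
ε` on `B`, so `ρ` raised by `ε` on `B` is still a lower bound of the accepted `ξ`. As `ρ` is the
greatest one and is finite, `B` is null. -/
theorem IsCPM.accepted_inducedRisk_add (hβ : IsCPM m P β zd zu) (hm : m ≤ mΩ)
    (hzd : zd < (z : EReal)) (hzu : (z : EReal) < zu) {X : Ω → ℝ} (hX : IsLinf mΩ P X)
    {ε : ℝ} (hε : 0 < ε) :
    ∀ᵐ ω ∂P, (z : EReal) ≤ β (fun ω' => (X ω' : EReal) +
      (inducedRisk m P β z (fun ω'' => (X ω'' : EReal)) ω' + (ε : EReal))) ω := by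
  classical
  set ρ := inducedRisk m P β z (fun ω => (X ω : EReal)) with hρ
  have hρL : IsLbb m P (fun ω => ρ ω + (ε : EReal)) :=
    (hβ.isLbb_inducedRisk hm hzd hzu hX).add (isLbb_const ε)
  have hXρ := hX.isLbb.add (hρL.mono_sigma hm)
  set B : Set Ω := {ω | β (fun ω' => (X ω' : EReal) + (ρ ω' + (ε : EReal))) ω < z}
  have hB : MeasurableSet[m] B := (hβ.maps _ hXρ).1 measurableSet_Iio
  have hinf := isEssInf_inducedRisk (P := P) hm β z (fun ω => (X ω : EReal))
  have key := hinf.greatest (B.piecewise (fun ω => ρ ω + (ε : EReal)) ρ)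
    ((Measurable.piecewise hB hρL.1 hinf.measurable).mono hm le_rfl) (by
      rintro ξ ⟨hξ, hz⟩
      have hC : MeasurableSet[m] {ω | ξ ω < ρ ω + (ε : EReal)} := measurableSet_lt hξ.1 hρL.1
      have h1 := hβ.local_mono hm (hX.isLbb.add (hξ.mono_sigma hm)) hXρ hC
        (Eventually.of_forall fun ω hω => add_le_add_right (le_of_lt hω) _)
      filter_upwards [h1, hz, hinf.le _ ⟨hξ, hz⟩] with ω h1 h2 h3
      by_cases hω : ω ∈ B
      · rw [Set.piecewise_eq_of_mem _ _ _ hω]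
        by_contra h4
        exact absurd ((h2.trans (h1 (not_le.1 h4))).trans_lt hω) (lt_irrefl _)
      · rwa [Set.piecewise_eq_of_notMem _ _ _ hω])
  filter_upwards [key, hβ.coe_toReal_inducedRisk hm hzd hzu hX] with ω h1 h2
  by_contra h3
  rw [Set.piecewise_eq_of_mem _ _ _ (show ω ∈ B from not_le.1 h3)] at h1
  change ρ ω + (ε : EReal) ≤ ρ ω at h1
  rw [← hρ] at h2
  rw [← h2, ← EReal.coe_add, EReal.coe_le_coe_iff] at h1
  linarith

/-- The real-valued version of the induced risk measure on bounded positions. -/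
noncomputable def realRisk (m : MeasurableSpace Ω) {mΩ : MeasurableSpace Ω} (P : Measure Ω)
    (β : (Ω → EReal) → Ω → EReal) (z : ℝ) (X : Ω → ℝ) (ω : Ω) : ℝ :=
  (inducedRisk m P β z (fun ω' => (X ω' : EReal)) ω).toReal

theorem IsCPM.accepted_realRisk_add (hβ : IsCPM m P β zd zu) (hm : m ≤ mΩ)
    (hzd : zd < (z : EReal)) (hzu : (z : EReal) < zu) {X : Ω → ℝ} (hX : IsLinf mΩ P X)
    {ε : ℝ} (hε : 0 < ε) :
    IsLbb m P (fun ω => ((realRisk m P β z X ω + ε : ℝ) : EReal)) ∧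
    ∀ᵐ ω ∂P, (z : EReal) ≤ β (fun ω' => ((X ω' + (realRisk m P β z X ω' + ε) : ℝ) : EReal)) ω := by
  have hco := hβ.coe_toReal_inducedRisk hm hzd hzu hX
  have hρ := hβ.isLbb_inducedRisk hm hzd hzu hX
  have hL : IsLbb m P (fun ω => ((realRisk m P β z X ω + ε : ℝ) : EReal)) := by
    refine ⟨(hρ.1.ereal_toReal.add_const ε).coe_real_ereal, ?_⟩
    obtain ⟨c, hc⟩ := hρ.2
    refine ⟨c + ε, ?_⟩
    filter_upwards [hco, hc] with ω h1 h2
    rw [← h1, EReal.coe_le_coe_iff] at h2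
    exact EReal.coe_le_coe_iff.2 (add_le_add_left h2 ε)
  refine ⟨hL, ?_⟩
  have h1 := hβ.mono _ _ (hX.isLbb.add (hL.mono_sigma hm))
    (hX.isLbb.add ((hρ.add (isLbb_const ε)).mono_sigma hm)) (by
      filter_upwards [hco] with ω h
      rw [← h, realRisk, ← EReal.coe_add])
  filter_upwards [hβ.accepted_inducedRisk_add hm hzd hzu hX hε, h1] with ω h2 h3
  simpa only [EReal.coe_add] using h2.trans h3

/-- Converse of `accepted_realRisk_add`. The slack `ε` stays in the hypothesis because continuity
from below gives no control of `β` as `ε ↓ 0`. -/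
theorem IsCPM.realRisk_le (hβ : IsCPM m P β zd zu) (hm : m ≤ mΩ)
    (hzd : zd < (z : EReal)) (hzu : (z : EReal) < zu) {X ξ : Ω → ℝ} (hX : IsLinf mΩ P X)
    (h : ∀ ε : ℝ, 0 < ε → IsLbb m P (fun ω => ((ξ ω + ε : ℝ) : EReal)) ∧
      ∀ᵐ ω ∂P, (z : EReal) ≤ β (fun ω' => ((X ω' + (ξ ω' + ε) : ℝ) : EReal)) ω) :
    realRisk m P β z X ≤ᵐ[P] ξ := by
  have hk : ∀ k : ℕ, ∀ᵐ ω ∂P, realRisk m P β z X ω ≤ ξ ω + 1 / ((k : ℝ) + 1) := by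
    intro k
    obtain ⟨h1, h2⟩ := h (1 / ((k : ℝ) + 1)) (by positivity)
    simp only [EReal.coe_add] at h2
    have h3 := (isEssInf_inducedRisk hm β z _).le _ ⟨h1, by simpa only [EReal.coe_add] using h2⟩
    filter_upwards [h3, hβ.coe_toReal_inducedRisk hm hzd hzu hX] with ω h3 h4
    rw [← h4, EReal.coe_le_coe_iff] at h3
    exact h3
  filter_upwards [ae_all_iff.2 hk] with ω hω
  have := (tendsto_one_div_add_atTop_nhds_zero_nat (𝕜 := ℝ)).const_add (ξ ω)
  rw [add_zero] at this
  exact ge_of_tendsto' this hω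

theorem IsCPM.isCondRisk (hβ : IsCPM m P β zd zu) (hm : m ≤ mΩ)
    (hzd : zd < (z : EReal)) (hzu : (z : EReal) < zu) :
    IsCondRisk m P (realRisk m P β z) where
  measurable X _ := (isEssInf_inducedRisk hm β z _).measurable.ereal_toReal
  anti X Y hX hY h := by
    filter_upwards [hβ.inducedRisk_anti (z := z) hm hX.isLbb hY.isLbb (by
        filter_upwards [h] with ω hω
        exact_mod_cast hω), hβ.coe_toReal_inducedRisk hm hzd hzu hX,
      hβ.coe_toReal_inducedRisk hm hzd hzu hY] with ω h1 h2 h3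
    rwa [← h2, ← h3, EReal.coe_le_coe_iff] at h1
  add_le X η hX hη := by
    refine hβ.realRisk_le hm hzd hzu (hX.add (hη.mono_sigma hm)) fun ε hε => ?_
    obtain ⟨h1, h2⟩ := hβ.accepted_realRisk_add hm hzd hzu hX hε
    refine ⟨?_, ?_⟩
    · have := h1.add hη.neg.isLbb
      simp only [← EReal.coe_add] at this
      convert this using 3
      ring
    · convert h2 using 6
      ring
  convex X Y hX hY a b ha hb hab := by
    refine hβ.realRisk_le hm hzd hzu ((hX.const_mul a).add (hY.const_mul b)) fun ε hε => ?_
    obtain ⟨h1, h2⟩ := hβ.accepted_realRisk_add hm hzd hzu hX hε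
    obtain ⟨h3, h4⟩ := hβ.accepted_realRisk_add hm hzd hzu hY hε
    have hb' : b = 1 - a := by linarith
    refine ⟨⟨?_, ?_⟩, ?_⟩
    · have := (isEssInf_inducedRisk (P := P) hm β z
        (fun ω => (X ω : EReal))).measurable.ereal_toReal
      have := (isEssInf_inducedRisk (P := P) hm β z
        (fun ω => (Y ω : EReal))).measurable.ereal_toReal
      unfold realRisk
      fun_prop
    · obtain ⟨c, hc⟩ := h1.2
      obtain ⟨d, hd⟩ := h3.2
      refine ⟨a * c + b * d, ?_⟩
      filter_upwards [hc, hd] with ω h5 h6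
      rw [EReal.coe_le_coe_iff] at h5 h6 ⊢
      have h7 := mul_le_mul_of_nonneg_left h5 ha
      have h8 := mul_le_mul_of_nonneg_left h6 hb
      have h9 : ε = a * ε + b * ε := by rw [← add_mul, hab, one_mul]
      linarith
    -- Both hedged positions have performance at least `z`, hence so does their mixture, which is
    -- the mixed position hedged by the mixed risks plus `ε`.
    · have h5 := hβ.quasiconcave a ha (by linarith) _ _
        (hX.isLbb.add (h1.mono_sigma hm)) (hY.isLbb.add (h3.mono_sigma hm))
      simp only [← EReal.coe_add, ← EReal.coe_mul] at h5
      filter_upwards [h2, h4, h5] with ω h2 h4 h5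
      refine (le_min h2 h4).trans (h5.trans (le_of_eq ?_))
      congr 1
      funext ω'
      rw [EReal.coe_eq_coe_iff, hb']
      ring
  continuous_below X Y hX hY h := by
    have h1 := hβ.inducedRisk_tendsto_of_monotone hm hzd hzu (fun n => (hX n).isLbb) hY.isLbb (by
      filter_upwards [h] with ω hω
      exact ⟨fun i j hij => EReal.coe_le_coe_iff.2 (hω.1 hij),
        (continuous_coe_real_ereal.tendsto _).comp hω.2⟩)
    filter_upwards [h1, hβ.inducedRisk_lt_top hm hzu hY.isLbb,
      (hβ.isLbb_inducedRisk hm hzd hzu hY).ne_bot] with ω h1 h2 h3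
    exact (EReal.tendsto_toReal h2.ne h3).comp h1

end Bounded

/-! ### Algebraic subgradients of convex functions. -/

/-- A finite convex function on a real vector space has an affine minorant touching it at any
given point. -/
theorem exists_linearMap_le_of_convex {E : Type*} [AddCommGroup E] [Module ℝ E] {f : E → ℝ}
    (hf : ConvexOn ℝ Set.univ f) (x : E) :
    ∃ g : E →ₗ[ℝ] ℝ, ∀ y, g y ≤ f (x + y) - f x := by
  -- The infimum of these quotients over `t > 0` is the directional derivative `N` of `f` at `x`; it
  -- is sublinear and lies below the quotient at `t = 1`.
  let q : E → ℝ → ℝ := fun y t => t⁻¹ * (f (x + t • y) - f x)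
  have hbdd : ∀ y, ∀ t : ℝ, 0 < t → -(f (x - y) - f x) ≤ q y t := by
    intro y t ht
    have h1 : 0 < 1 + t := by linarith
    -- `x` is a convex combination of `x + t • y` and `x - y`, which bounds the quotients below
    -- uniformly in `t`.
    have h := hf.2 (Set.mem_univ (x + t • y)) (Set.mem_univ (x - y))
      (show 0 ≤ 1 / (1 + t) by positivity) (show 0 ≤ t / (1 + t) by positivity) (by field_simp)
    have hx : (1 / (1 + t)) • (x + t • y) + (t / (1 + t)) • (x - y) = x := by
      match_scalars <;> field_simp
      ring
    rw [hx, smul_eq_mul, smul_eq_mul] at h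
    have h2 : (1 + t) * f x ≤ f (x + t • y) + t * f (x - y) := by
      calc (1 + t) * f x ≤ (1 + t) * (1 / (1 + t) * f (x + t • y) + t / (1 + t) * f (x - y)) :=
            mul_le_mul_of_nonneg_left h h1.le
        _ = _ := by field_simp
    have h3 : t * -(f (x - y) - f x) ≤ f (x + t • y) - f x := by linarith
    calc -(f (x - y) - f x) = t⁻¹ * (t * -(f (x - y) - f x)) := by field_simp
      _ ≤ q y t := mul_le_mul_of_nonneg_left h3 (by positivity)
  let S : E → Set ℝ := fun y => q y '' Set.Ioi 0
  have hS : ∀ y, BddBelow (S y) := fun y => ⟨-(f (x - y) - f x), by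
    rintro _ ⟨t, ht, rfl⟩
    exact hbdd y t ht⟩
  have hne : ∀ y, (S y).Nonempty := fun y => ⟨_, 1, Set.mem_Ioi.2 one_pos, rfl⟩
  let N : E → ℝ := fun y => sInf (S y)
  have hhom_le : ∀ c : ℝ, 0 < c → ∀ y, N (c • y) ≤ c * N y := by
    intro c hc y
    rw [← div_le_iff₀' hc]
    refine le_csInf (hne y) ?_
    rintro _ ⟨t, ht, rfl⟩
    rw [div_le_iff₀' hc]
    have ht' : (0 : ℝ) < t := ht
    refine csInf_le (hS _) ⟨t / c, Set.mem_Ioi.2 (by positivity), ?_⟩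
    simp only [q, smul_smul, div_mul_cancel₀ _ hc.ne']
    field_simp
  have hhom : ∀ c : ℝ, 0 < c → ∀ y, N (c • y) = c * N y := by
    intro c hc y
    refine le_antisymm (hhom_le c hc y) ?_
    have h := hhom_le c⁻¹ (inv_pos.2 hc) (c • y)
    rw [smul_smul, inv_mul_cancel₀ hc.ne', one_smul] at h
    calc c * N y ≤ c * (c⁻¹ * N (c • y)) := mul_le_mul_of_nonneg_left h hc.le
      _ = N (c • y) := by field_simp
  have hadd : ∀ y w, N (y + w) ≤ N y + N w := by
    intro y w
    have key : ∀ s ∈ S y, ∀ t ∈ S w, N (y + w) ≤ s + t := by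
      rintro _ ⟨s, hs, rfl⟩ _ ⟨t, ht, rfl⟩
      have hs' : (0 : ℝ) < s := hs
      have ht' : (0 : ℝ) < t := ht
      have hst : 0 < s + t := by linarith
      -- Weights `t / (s + t)` and `s / (s + t)` give both directions the common step `s * t / (s +
      -- t)`.
      refine (csInf_le (hS _) ⟨s * t / (s + t), Set.mem_Ioi.2 (by positivity), rfl⟩).trans ?_
      have h := hf.2 (Set.mem_univ (x + s • y)) (Set.mem_univ (x + t • w))
        (show 0 ≤ t / (s + t) by positivity) (show 0 ≤ s / (s + t) by positivity)
        (by field_simp; ring)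
      have hx : (t / (s + t)) • (x + s • y) + (s / (s + t)) • (x + t • w)
          = x + (s * t / (s + t)) • (y + w) := by
        match_scalars <;> field_simp
        ring
      rw [hx, smul_eq_mul, smul_eq_mul] at h
      calc q (y + w) (s * t / (s + t))
          ≤ (s * t / (s + t))⁻¹ * (t / (s + t) * f (x + s • y) + s / (s + t) * f (x + t • w)
            - f x) := mul_le_mul_of_nonneg_left (by linarith) (by positivity)
        _ = q y s + q w t := by
          simp only [q]
          field_simp
          ring
    have h1 : ∀ s ∈ S y, N (y + w) - s ≤ N w := fun s hs =>
      le_csInf (hne w) fun t ht => by linarith [key s hs t ht]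
    have h2 : N (y + w) - N w ≤ N y := le_csInf (hne y) fun s hs => by linarith [h1 s hs]
    linarith
  have hN0 : N 0 = 0 := by
    have : S 0 = {0} := by
      ext a
      constructor
      · rintro ⟨t, -, rfl⟩
        simp [q]
      · rintro rfl
        exact ⟨1, Set.mem_Ioi.2 one_pos, by simp [q]⟩
    simp [N, this]
  obtain ⟨g, -, hg⟩ := exists_extension_of_le_sublinear (⊥ : E →ₗ.[ℝ] ℝ) N hhom hadd (by
    rintro ⟨y, hy⟩
    have hy0 : y = 0 := (Submodule.mem_bot ℝ).1 hy
    subst hy0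
    have : (⊥ : E →ₗ.[ℝ] ℝ) ⟨0, hy⟩ = 0 := LinearPMap.map_zero _
    rw [this, hN0])
  refine ⟨g, fun y => (hg y).trans ?_⟩
  exact csInf_le (hS y) ⟨1, Set.mem_Ioi.2 one_pos, by simp [q]⟩

/-! ### Representing positive functionals on bounded variables by measures. -/

section Representation

variable {Ω : Type*} {mΩ : MeasurableSpace Ω} {P : Measure Ω}

/-- The indicator function of a measurable set, as a bounded random variable. -/
noncomputable def linfIndicator (P : Measure Ω) {A : Set Ω} (hA : MeasurableSet A) : linf P :=
  ⟨A.indicator (fun _ => (1 : ℝ)), isLinf_indicator_one hA⟩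

theorem linf_le_of_ae_le {L : linf P →ₗ[ℝ] ℝ} (hpos : ∀ X : linf P, 0 ≤ᵐ[P] X.1 → 0 ≤ L X)
    {X Y : linf P} (h : X.1 ≤ᵐ[P] Y.1) : L X ≤ L Y := by
  have := hpos (Y - X) (by
    filter_upwards [h] with ω hω
    exact sub_nonneg.2 hω)
  rw [map_sub] at this
  linarith

/-- A positive normalized functional on the bounded random variables that is continuous along
increasing sequences of events exhausting the space is the expectation under an absolutely
continuous probability measure. -/
theorem exists_measure_of_linf_functional (L : linf P →ₗ[ℝ] ℝ)
    (hpos : ∀ X : linf P, 0 ≤ᵐ[P] X.1 → 0 ≤ L X)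
    (hone : L (linfIndicator P MeasurableSet.univ) = 1)
    (hcont : ∀ (A : ℕ → Set Ω) (hA : ∀ n, MeasurableSet (A n)), Monotone A →
      ⋃ n, A n = Set.univ → Tendsto (fun n => L (linfIndicator P (hA n))) atTop (𝓝 1)) :
    ∃ Q : Measure Ω, IsProbabilityMeasure Q ∧ Q ≪ P ∧
      (∀ A (hA : MeasurableSet A), Q A = ENNReal.ofReal (L (linfIndicator P hA))) ∧
      ∀ X : linf P, L X = ∫ ω, X.1 ω ∂Q := by
  have hnn : ∀ {A : Set Ω} (hA : MeasurableSet A), 0 ≤ L (linfIndicator P hA) := fun hA =>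
    hpos _ (Eventually.of_forall fun ω => Set.indicator_nonneg (fun _ _ => zero_le_one) ω)
  have hnull : ∀ {A : Set Ω} (hA : MeasurableSet A), P A = 0 → L (linfIndicator P hA) = 0 := by
    intro A hA h0
    refine le_antisymm ?_ (hnn hA)
    have := linf_le_of_ae_le hpos (X := linfIndicator P hA) (Y := 0) (by
      filter_upwards [measure_eq_zero_iff_ae_notMem.1 h0] with ω hω
      simp [linfIndicator, hω])
    simpa using this
  have hsum : ∀ (f : ℕ → Set Ω) (hf : ∀ i, MeasurableSet (f i)),
      Pairwise (Function.onFun Disjoint f) →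
      HasSum (fun i => L (linfIndicator P (hf i)))
        (L (linfIndicator P (MeasurableSet.iUnion hf))) := by
    intro f hf hd
    rw [hasSum_iff_tendsto_nat_of_nonneg fun i => hnn (hf i)]
    have hU := MeasurableSet.iUnion hf
    -- Adding the complement of the whole union makes the partial unions exhaust `Ω`, as `hcont`
    -- requires.
    let A : ℕ → Set Ω := fun n => (⋃ i ∈ Finset.range n, f i) ∪ (⋃ i, f i)ᶜ
    have hA : ∀ n, MeasurableSet (A n) := fun n =>
      (Finset.measurableSet_biUnion _ fun i _ => hf i).union hU.compl
    have hlim := hcont A hA (fun i j hij => Set.union_subset_union_left _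
      (Set.biUnion_subset_biUnion_left (by simpa using hij))) (by
        ext ω
        simp only [A, Set.mem_iUnion, Set.mem_union, Set.mem_compl_iff, Set.mem_univ, iff_true]
        by_cases h : ∃ i, ω ∈ f i
        · obtain ⟨i, hi⟩ := h
          exact ⟨i + 1, Or.inl ⟨i, by simp, hi⟩⟩
        · exact ⟨0, Or.inr h⟩)
    have hAn : ∀ n, L (linfIndicator P (hA n)) = ∑ i ∈ Finset.range n, L (linfIndicator P (hf i))
        + L (linfIndicator P hU.compl) := by
      intro n
      rw [← map_sum, ← map_add]
      congr 1
      apply Subtype.ext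
      funext ω
      simp only [linfIndicator, Submodule.coe_add, Submodule.coe_sum, Pi.add_apply,
        Finset.sum_apply]
      rw [Set.indicator_union_of_disjoint, Finset.indicator_biUnion]
      · exact fun i _ j _ hij => hd hij
      · rw [Set.disjoint_compl_right_iff_subset]
        exact Set.iUnion₂_subset fun i _ => Set.subset_iUnion f i
    have hUc : L (linfIndicator P hU) + L (linfIndicator P hU.compl) = 1 := by
      rw [← hone, ← map_add]
      congr 1
      apply Subtype.ext
      funext ω
      exact (congrFun (Set.indicator_self_add_compl (⋃ i, f i) fun _ => (1 : ℝ)) ω).trans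
        (congrFun (Set.indicator_univ fun _ => (1 : ℝ)) ω).symm
    simp only [hAn] at hlim
    have := hlim.sub_const (L (linfIndicator P hU.compl))
    simp only [add_sub_cancel_right] at this
    rwa [← hUc, add_sub_cancel_right] at this
  let Q : Measure Ω := Measure.ofMeasurable
    (fun A hA => ENNReal.ofReal (L (linfIndicator P hA)))
    (by rw [hnull MeasurableSet.empty measure_empty, ENNReal.ofReal_zero])
    (fun f hf hd => by
      rw [← (hsum f hf hd).tsum_eq]
      exact ENNReal.ofReal_tsum_of_nonneg (fun i => hnn (hf i)) (hsum f hf hd).summable)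
  have hQ : ∀ A (hA : MeasurableSet A), Q A = ENNReal.ofReal (L (linfIndicator P hA)) :=
    fun A hA => Measure.ofMeasurable_apply A hA
  have hQp : IsProbabilityMeasure Q := ⟨by rw [hQ _ MeasurableSet.univ, hone, ENNReal.ofReal_one]⟩
  have hQP : Q ≪ P := Measure.AbsolutelyContinuous.mk fun A hA h0 => by
    rw [hQ A hA, hnull hA h0, ENNReal.ofReal_zero]
  refine ⟨Q, hQp, hQP, hQ, fun X => ?_⟩
  have hint : ∀ Y : linf P, Integrable Y.1 Q := fun Y => IsLinf.integrable Y.2 hQP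
  have hbound : ∀ (Y : linf P) (c : ℝ), (∀ᵐ ω ∂P, |Y.1 ω| ≤ c) → |L Y| ≤ c := by
    intro Y c hc
    have h1 := linf_le_of_ae_le hpos (X := Y) (Y := c • linfIndicator P MeasurableSet.univ) (by
      filter_upwards [hc] with ω hω
      simpa [linfIndicator] using (abs_le.1 hω).2)
    have h2 := linf_le_of_ae_le hpos (X := (-c) • linfIndicator P MeasurableSet.univ) (Y := Y) (by
      filter_upwards [hc] with ω hω
      simpa [linfIndicator] using (abs_le.1 hω).1)
    rw [map_smul, hone, smul_eq_mul, mul_one] at h1 h2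
    exact abs_le.2 ⟨h2, h1⟩
  have happrox : ∀ n : ℕ, |L X - ∫ ω, X.1 ω ∂Q| ≤ 2 * (1 / ((n : ℝ) + 1)) := by
    intro n
    have hn : (0 : ℝ) < (n : ℝ) + 1 := by positivity
    obtain ⟨c, hc⟩ := X.2.2
    -- The extra one covers negative values, where the floor can fall below `-⌈(n + 1) * c⌉`.
    let K : ℤ := ⌈((n : ℝ) + 1) * c⌉ + 1
    let A : ℤ → Set Ω := fun k => {ω | ⌊((n : ℝ) + 1) * X.1 ω⌋ = k}
    have hA : ∀ k, MeasurableSet (A k) := fun k =>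
      (Int.measurable_floor.comp (X.2.1.const_mul _)) (measurableSet_singleton k)
    -- Rounding `X` down to multiples of `1 / (n + 1)` gives a simple function on which `L` and the
    -- integral agree; both move by at most `1 / (n + 1)` from `X` to `Y`.
    let Y : linf P := ∑ k ∈ Finset.Icc (-K) K, ((k : ℝ) / ((n : ℝ) + 1)) • linfIndicator P (hA k)
    have hYL : L Y = ∫ ω, Y.1 ω ∂Q := by
      simp only [Y, map_sum, map_smul, smul_eq_mul, Submodule.coe_sum, Submodule.coe_smul,
        Finset.sum_apply, Pi.smul_apply]
      rw [integral_finsetSum _ fun k _ => (hint (linfIndicator P (hA k))).const_mul _]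
      refine Finset.sum_congr rfl fun k _ => ?_
      rw [integral_const_mul]
      congr 1
      simp only [linfIndicator]
      rw [integral_indicator (hA k), setIntegral_const, smul_eq_mul, mul_one, measureReal_def,
        hQ _ (hA k), ENNReal.toReal_ofReal (hnn _)]
      rfl
    have hXY : ∀ᵐ ω ∂P, |(X - Y).1 ω| ≤ 1 / ((n : ℝ) + 1) := by
      filter_upwards [hc] with ω hω
      set k : ℤ := ⌊((n : ℝ) + 1) * X.1 ω⌋ with hk
      have hk1 : (k : ℝ) ≤ ((n : ℝ) + 1) * X.1 ω := Int.floor_le _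
      have hk2 : ((n : ℝ) + 1) * X.1 ω < k + 1 := Int.lt_floor_add_one _
      have hb := abs_le.1 hω
      have hceil : ((n : ℝ) + 1) * c ≤ (⌈((n : ℝ) + 1) * c⌉ : ℝ) := Int.le_ceil _
      have hb1 : ((n : ℝ) + 1) * X.1 ω ≤ ((n : ℝ) + 1) * c :=
        mul_le_mul_of_nonneg_left hb.2 hn.le
      have hb2 : -(((n : ℝ) + 1) * c) ≤ ((n : ℝ) + 1) * X.1 ω := by
        rw [← mul_neg]
        exact mul_le_mul_of_nonneg_left hb.1 hn.le
      have hmem : k ∈ Finset.Icc (-K) K := by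
        rw [Finset.mem_Icc]
        constructor
        · have : (-K : ℝ) ≤ k := by
            simp only [K]
            push_cast
            linarith
          exact_mod_cast this
        · have : (k : ℝ) ≤ K := by
            simp only [K]
            push_cast
            linarith
          exact_mod_cast this
      have hY : Y.1 ω = (k : ℝ) / ((n : ℝ) + 1) := by
        simp only [Y, linfIndicator, Submodule.coe_sum, Submodule.coe_smul, Finset.sum_apply,
          Pi.smul_apply, smul_eq_mul]
        rw [Finset.sum_eq_single_of_mem k hmem]
        · rw [Set.indicator_of_mem (show ω ∈ A k from rfl), mul_one]
        · intro j _ hj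
          rw [Set.indicator_of_notMem (show ω ∉ A j from fun h => hj (Eq.symm h)), mul_zero]
      have : (X - Y).1 ω = X.1 ω - (k : ℝ) / ((n : ℝ) + 1) := by
        rw [← hY]
        rfl
      rw [this, show X.1 ω - (k : ℝ) / ((n : ℝ) + 1)
        = (((n : ℝ) + 1) * X.1 ω - k) / ((n : ℝ) + 1) by field_simp, abs_div, abs_of_pos hn]
      gcongr
      exact abs_le.2 ⟨by linarith, by linarith⟩
    have h1 := hbound _ _ hXY
    have h2 : |∫ ω, (X - Y).1 ω ∂Q| ≤ 1 / ((n : ℝ) + 1) := by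
      have := norm_integral_le_of_norm_le_const (μ := Q) (f := (X - Y).1)
        (C := 1 / ((n : ℝ) + 1)) (hQP.ae_le hXY)
      simpa using this
    have h3 : ∫ ω, (X - Y).1 ω ∂Q = ∫ ω, X.1 ω ∂Q - ∫ ω, Y.1 ω ∂Q :=
      integral_sub (hint X) (hint Y)
    rw [map_sub] at h1
    rw [h3] at h2
    calc |L X - ∫ ω, X.1 ω ∂Q|
        = |(L X - L Y) - (∫ ω, X.1 ω ∂Q - ∫ ω, Y.1 ω ∂Q)| := by rw [hYL]; congr 1; ring
      _ ≤ |L X - L Y| + |∫ ω, X.1 ω ∂Q - ∫ ω, Y.1 ω ∂Q| := abs_sub _ _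
      _ ≤ 2 * (1 / ((n : ℝ) + 1)) := by linarith
  have hlim := (tendsto_one_div_add_atTop_nhds_zero_nat (𝕜 := ℝ)).const_mul 2
  rw [mul_zero] at hlim
  have := ge_of_tendsto' hlim happrox
  exact sub_eq_zero.1 (abs_nonpos_iff.1 this)

end Representation

/-! ### Supporting measures of conditional risk measures. -/

section Subgradient

variable {Ω : Type*} {m mΩ : MeasurableSpace Ω} {P : Measure Ω} {r : (Ω → ℝ) → Ω → ℝ}

/-- The inequality `add_le`, applied to `X + η` and the shift `-η`, reverses itself. -/
theorem IsCondRisk.add_eq (hr : IsCondRisk m P r) (hm : m ≤ mΩ) {X η : Ω → ℝ}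
    (hX : IsLinf mΩ P X) (hη : IsLinf m P η) :
    ∀ᵐ ω ∂P, r (fun ω' => X ω' + η ω') ω = r X ω - η ω := by
  have h1 := hr.add_le _ _ (hX.add (hη.mono_sigma hm)) hη.neg
  simp only [add_neg_cancel_right] at h1
  filter_upwards [hr.add_le X η hX hη, h1] with ω h1 h2
  linarith

theorem IsCondRisk.sub_le (hr : IsCondRisk m P r) (hm : m ≤ mΩ) {X Y η : Ω → ℝ}
    (hX : IsLinf mΩ P X) (hY : IsLinf mΩ P Y) (hη : IsLinf m P η)
    (h : ∀ᵐ ω ∂P, X ω ≤ Y ω + η ω) : ∀ᵐ ω ∂P, r Y ω - η ω ≤ r X ω := by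
  filter_upwards [hr.add_eq hm hY hη, hr.anti _ _ hX (hY.add (hη.mono_sigma hm)) h] with ω h1 h2
  rwa [← h1]

theorem IsCondRisk.abs_sub_le (hr : IsCondRisk m P r) (hm : m ≤ mΩ) {X Y : Ω → ℝ}
    (hX : IsLinf mΩ P X) (hY : IsLinf mΩ P Y) {c : ℝ} (h : ∀ᵐ ω ∂P, |X ω - Y ω| ≤ c) :
    ∀ᵐ ω ∂P, |r X ω - r Y ω| ≤ c := by
  have h1 := hr.sub_le hm hX hY (isLinf_const c) (by
    filter_upwards [h] with ω hω
    linarith [(abs_le.1 hω).2])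
  have h2 := hr.sub_le hm hY hX (isLinf_const c) (by
    filter_upwards [h] with ω hω
    linarith [(abs_le.1 hω).1])
  filter_upwards [h1, h2] with ω h1 h2
  exact abs_le.2 ⟨by linarith, by linarith⟩

/-- `r X` itself is not assumed integrable; only such differences are integrated below. -/
theorem IsCondRisk.isLinf_sub (hr : IsCondRisk m P r) (hm : m ≤ mΩ) {X Y : Ω → ℝ}
    (hX : IsLinf mΩ P X) (hY : IsLinf mΩ P Y) : IsLinf m P (fun ω => r X ω - r Y ω) := by
  obtain ⟨c, hc⟩ := (hX.sub hY).2
  exact ⟨(hr.measurable X hX).sub (hr.measurable Y hY), c, hr.abs_sub_le hm hX hY hc⟩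

theorem IsCondRisk.integrable_sub [IsFiniteMeasure P] (hr : IsCondRisk m P r) (hm : m ≤ mΩ)
    {X Y : Ω → ℝ} (hX : IsLinf mΩ P X) (hY : IsLinf mΩ P Y) :
    Integrable (fun ω => r X ω - r Y ω) P :=
  ((hr.isLinf_sub hm hX hY).mono_sigma hm).integrable Measure.AbsolutelyContinuous.rfl

/-- `X` and `Y` differ by at most the `m`-measurable shift `c` carried by `Bᶜ`, and such a shift
leaves the risk unchanged on `B`. -/
theorem IsCondRisk.eq_on (hr : IsCondRisk m P r) (hm : m ≤ mΩ) {X Y : Ω → ℝ}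
    (hX : IsLinf mΩ P X) (hY : IsLinf mΩ P Y) {B : Set Ω} (hB : MeasurableSet[m] B)
    (h : ∀ ω ∈ B, X ω = Y ω) : ∀ᵐ ω ∂P, ω ∈ B → r X ω = r Y ω := by
  obtain ⟨c, hc⟩ := (hX.sub hY).2
  have hη : IsLinf m P (Bᶜ.indicator fun _ => c) := (isLinf_const c).indicator hB.compl
  have hle : ∀ᵐ ω ∂P, |X ω - Y ω| ≤ Bᶜ.indicator (fun _ => c) ω := by
    filter_upwards [hc] with ω hω
    by_cases hb : ω ∈ B
    · simp [hb, h ω hb]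
    · simpa [hb] using hω
  have h1 := hr.sub_le hm hX hY hη (by
    filter_upwards [hle] with ω hω
    linarith [(abs_le.1 hω).2])
  have h2 := hr.sub_le hm hY hX hη (by
    filter_upwards [hle] with ω hω
    linarith [(abs_le.1 hω).1])
  filter_upwards [h1, h2] with ω h1 h2 hb
  simp only [Set.mem_compl_iff, hb, not_true_eq_false, not_false_eq_true,
    Set.indicator_of_notMem, sub_zero] at h1 h2
  exact le_antisymm h2 h1

/-- Integrated subgradients: at every bounded position, a conditional risk measure that is
continuous from below has a supporting probability measure that agrees with `P` on `m`. -/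
theorem IsCondRisk.exists_setIntegral_le [IsProbabilityMeasure P] (hr : IsCondRisk m P r)
    (hm : m ≤ mΩ) {X : Ω → ℝ} (hX : IsLinf mΩ P X) :
    ∃ Q ∈ dualMeasures m P, ∀ Y, IsLinf mΩ P Y → ∀ B, MeasurableSet[m] B →
      ∫ ω in B, (r X ω - r Y ω) ∂P ≤ ∫ ω in B, (Y ω - X ω) ∂Q := by
  let f : linf P → ℝ := fun Y => ∫ ω, (r Y.1 ω - r X ω) ∂P
  have hint : ∀ Y : linf P, Integrable (fun ω => r Y.1 ω - r X ω) P := fun Y =>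
    hr.integrable_sub hm Y.2 hX
  have hf : ConvexOn ℝ Set.univ f := by
    refine ⟨convex_univ, fun Y _ Z _ a b ha hb hab => ?_⟩
    simp only [f, smul_eq_mul]
    rw [← integral_const_mul, ← integral_const_mul,
      ← integral_add ((hint Y).const_mul a) ((hint Z).const_mul b)]
    refine integral_mono_ae (hint _) (((hint Y).const_mul a).add ((hint Z).const_mul b)) ?_
    filter_upwards [hr.convex Y.1 Z.1 Y.2 Z.2 a b ha hb hab] with ω hω
    have h1 : r X ω = a * r X ω + b * r X ω := by rw [← add_mul, hab, one_mul]
    change r (fun ω' => a * Y.1 ω' + b * Z.1 ω') ω - r X ω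
      ≤ a * (r Y.1 ω - r X ω) + b * (r Z.1 ω - r X ω)
    linarith
  have hf0 : f ⟨X, hX⟩ = 0 := by simp [f]
  obtain ⟨g, hg⟩ := exists_linearMap_le_of_convex hf ⟨X, hX⟩
  rw [hf0] at hg
  simp only [sub_zero] at hg
  have hpos : ∀ Y : linf P, 0 ≤ᵐ[P] Y.1 → 0 ≤ (-g) Y := by
    intro Y hY
    rw [LinearMap.neg_apply, neg_nonneg]
    refine (hg Y).trans (integral_nonpos_of_ae ?_)
    filter_upwards [hr.anti X (fun ω => X ω + Y.1 ω) hX (hX.add Y.2) (by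
      filter_upwards [hY] with ω hω
      simpa using hω)] with ω hω
    exact sub_nonpos.2 hω
  have hfm : ∀ (B : Set Ω) (hB : MeasurableSet[m] B) (c : ℝ),
      f (⟨X, hX⟩ + c • linfIndicator P (hm _ hB)) = -(c * P.real B) := by
    intro B hB c
    have h1 := hr.add_eq hm hX (((isLinf_indicator_one hB).const_mul c))
    have h2 : ∫ ω, -(c * B.indicator (fun _ => (1 : ℝ)) ω) ∂P = -(c * P.real B) := by
      rw [integral_neg, integral_const_mul, integral_indicator (hm _ hB)]
      simp
    rw [← h2]
    refine integral_congr_ae ?_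
    filter_upwards [h1] with ω hω
    change r (fun ω' => X ω' + c * B.indicator (fun _ => (1 : ℝ)) ω') ω - r X ω = _
    rw [hω]
    ring
  -- In the direction of an `m`-measurable indicator `f` is affine, so the support inequality at
  -- steps `1` and `-1` forces equality.
  have hgm : ∀ (B : Set Ω) (hB : MeasurableSet[m] B),
      (-g) (linfIndicator P (hm _ hB)) = P.real B := by
    intro B hB
    have h1 := hg ((1 : ℝ) • linfIndicator P (hm _ hB))
    have h2 := hg ((-1 : ℝ) • linfIndicator P (hm _ hB))
    rw [hfm B hB, map_smul, smul_eq_mul] at h1 h2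
    rw [LinearMap.neg_apply]
    linarith
  have hone : (-g) (linfIndicator P MeasurableSet.univ) = 1 :=
    (hgm Set.univ MeasurableSet.univ).trans (by simp)
  -- By cash invariance `f` equals `-1` at `X + 1`. Continuity from below gives `f (X + 1_{A n}) →
  -- -1`, so `-g (1_{A n})` is squeezed between `-f (X + 1_{A n})` and `1`.
  have hcont : ∀ (A : ℕ → Set Ω) (hA : ∀ n, MeasurableSet (A n)), Monotone A →
      ⋃ n, A n = Set.univ → Tendsto (fun n => (-g) (linfIndicator P (hA n))) atTop (𝓝 1) := by
    intro A hA hmono hU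
    have hXA : ∀ n, IsLinf mΩ P (fun ω => X ω + (A n).indicator (fun _ => (1 : ℝ)) ω) := fun n =>
      hX.add (isLinf_indicator_one (hA n))
    have h1 := hr.continuous_below (fun n ω => X ω + (A n).indicator (fun _ => (1 : ℝ)) ω)
      (fun ω => X ω + 1) hXA (hX.add (isLinf_const 1)) (Eventually.of_forall fun ω => by
        refine ⟨fun i j hij => add_le_add_right (Set.indicator_le_indicator_of_subset (hmono hij)
          (fun _ => zero_le_one) ω) _, ?_⟩
        obtain ⟨n, hn⟩ := Set.mem_iUnion.1 (hU ▸ Set.mem_univ ω)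
        refine tendsto_atTop_of_eventually_const (i₀ := n) fun k hk => ?_
        rw [Set.indicator_of_mem (hmono hk hn)])
    have h2 : Tendsto (fun n => f (⟨X, hX⟩ + linfIndicator P (hA n))) atTop
        (𝓝 (∫ ω, (-1 : ℝ) ∂P)) := by
      refine tendsto_integral_of_dominated_convergence (fun _ => (1 : ℝ))
        (fun n => (hint _).aestronglyMeasurable) (integrable_const 1) (fun n => ?_) ?_
      · refine hr.abs_sub_le hm (hXA n) hX (Eventually.of_forall fun ω => ?_)
        rw [add_sub_cancel_left]
        by_cases h : ω ∈ A n <;> simp [h]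
      · filter_upwards [h1, hr.add_eq hm hX (isLinf_const 1)] with ω h1 h2
        rw [h2] at h1
        have h3 := h1.sub_const (r X ω)
        rw [sub_sub_cancel_left] at h3
        exact h3
    have h3 := h2.neg
    simp only [integral_const, probReal_univ, smul_eq_mul, one_mul, neg_neg] at h3
    refine tendsto_of_tendsto_of_tendsto_of_le_of_le h3 tendsto_const_nhds (fun n => ?_)
      (fun n => ?_)
    · rw [LinearMap.neg_apply]
      exact neg_le_neg (hg _)
    · rw [← hone]
      exact linf_le_of_ae_le hpos (Eventually.of_forall fun ω =>
        Set.indicator_le_indicator_of_subset (Set.subset_univ _) (fun _ => zero_le_one) ω)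
  obtain ⟨Q, hQ1, hQP, hQ, hLQ⟩ := exists_measure_of_linf_functional (-g) hpos hone hcont
  refine ⟨Q, ⟨hQ1, hQP, fun B hB => ?_⟩, fun Y hY B hB => ?_⟩
  · rw [hQ B (hm _ hB), hgm B hB, ofReal_measureReal]
  -- Moving from `X` to `Y` only on `B` localizes the support inequality to `B`.
  · have hZ : IsLinf mΩ P (B.indicator fun ω => Y ω - X ω) := (hY.sub hX).indicator (hm _ hB)
    have h1 := hg ⟨_, hZ⟩
    have h2 := hLQ ⟨_, hZ⟩
    rw [LinearMap.neg_apply] at h2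
    simp only at h2
    rw [integral_indicator (hm _ hB)] at h2
    have h3 : f (⟨X, hX⟩ + ⟨_, hZ⟩) = ∫ ω in B, (r Y ω - r X ω) ∂P := by
      rw [← integral_indicator (hm _ hB)]
      refine integral_congr_ae ?_
      have hXZ : IsLinf mΩ P (fun ω => X ω + B.indicator (fun ω => Y ω - X ω) ω) := hX.add hZ
      filter_upwards [hr.eq_on hm hXZ hY hB (fun ω hω => by simp [hω]),
        hr.eq_on hm hXZ hX hB.compl (fun ω hω => by
          rw [Set.indicator_of_notMem hω, add_zero])] with ω h1 h2
      change r (fun ω => X ω + B.indicator (fun ω => Y ω - X ω) ω) ω - r X ω = _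
      by_cases hb : ω ∈ B
      · rw [h1 hb, Set.indicator_of_mem hb]
      · rw [h2 hb, Set.indicator_of_notMem hb, sub_self]
    have h4 : ∫ ω in B, (r X ω - r Y ω) ∂P = -∫ ω in B, (r Y ω - r X ω) ∂P := by
      rw [← integral_neg]
      simp
    rw [h3] at h1
    rw [h4]
    linarith

theorem trim_eq_of_mem_dualMeasures (hm : m ≤ mΩ) {Q : Measure Ω} (hQ : Q ∈ dualMeasures m P) :
    Q.trim hm = P.trim hm := by
  refine @Measure.ext _ m _ _ fun B hB => ?_
  rw [trim_measurableSet_eq hm hB, trim_measurableSet_eq hm hB, hQ.2.2 B hB]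

/-- Conditional subgradients of a conditional risk measure. -/
theorem IsCondRisk.exists_sub_le_condExp [IsProbabilityMeasure P] (hr : IsCondRisk m P r)
    (hm : m ≤ mΩ) {X : Ω → ℝ} (hX : IsLinf mΩ P X) :
    ∃ Q ∈ dualMeasures m P,
      (∀ Y, IsLinf mΩ P Y → ∫ ω, (r X ω - r Y ω) ∂P ≤ ∫ ω, (Y ω - X ω) ∂Q) ∧
      ∀ Y, IsLinf mΩ P Y → ∀ᵐ ω ∂P,
        r X ω - r Y ω ≤ (Q[(fun ω' => -X ω') | m]) ω - (Q[(fun ω' => -Y ω') | m]) ω := by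
  obtain ⟨Q, hQ, h⟩ := hr.exists_setIntegral_le hm hX
  refine ⟨Q, hQ, fun Y hY => by simpa using h Y hY Set.univ MeasurableSet.univ, fun Y hY => ?_⟩
  have hQp : IsProbabilityMeasure Q := hQ.1
  have hXi := hX.neg.integrable hQ.2.1
  have hYi := hY.neg.integrable hQ.2.1
  have hrm : StronglyMeasurable[m] (fun ω => r X ω - r Y ω) :=
    (hr.isLinf_sub hm hX hY).1.stronglyMeasurable
  have hcm : StronglyMeasurable[m]
      (fun ω => (Q[(fun ω' => -X ω') | m]) ω - (Q[(fun ω' => -Y ω') | m]) ω) :=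
    stronglyMeasurable_condExp.sub stronglyMeasurable_condExp
  have hci : Integrable
      (fun ω => (Q[(fun ω' => -X ω') | m]) ω - (Q[(fun ω' => -Y ω') | m]) ω) Q :=
    integrable_condExp.sub integrable_condExp
  -- Both sides are `m`-measurable and `P`, `Q` agree on `m`, so it suffices to compare integrals
  -- over events of `m`.
  refine ae_of_ae_trim hm (ae_le_of_forall_setIntegral_le
    ((hr.integrable_sub hm hX hY).trim hm hrm) ?_ fun B hB _ => ?_)
  · rw [← trim_eq_of_mem_dualMeasures hm hQ]
    exact hci.trim hm hcm
  · rw [← setIntegral_trim hm hrm hB]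
    refine (h Y hY B hB).trans (le_of_eq ?_)
    rw [← trim_eq_of_mem_dualMeasures hm hQ, ← setIntegral_trim hm hcm hB,
      integral_sub integrable_condExp.integrableOn integrable_condExp.integrableOn,
      setIntegral_condExp hm hXi hB, setIntegral_condExp hm hYi hB,
      ← integral_sub hXi.integrableOn hYi.integrableOn]
    congr 1
    funext ω
    ring

end Subgradient

/-! ### Robust representation and continuity from above. -/

section Duality

variable {Ω : Type*} {m mΩ : MeasurableSpace Ω} {P : Measure Ω} [IsProbabilityMeasure P]
  {β : (Ω → EReal) → Ω → EReal} {zd zu : EReal} {z : ℝ}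

theorem measurable_condLoss (m : MeasurableSpace Ω) {mΩ : MeasurableSpace Ω} (Q : Measure Ω)
    (X : Ω → ℝ) : Measurable[m] (condLoss m Q X) :=
  (stronglyMeasurable_condExp (μ := Q)).measurable.coe_real_ereal

theorem isEssSup_minPenalty (hm : m ≤ mΩ) (β : (Ω → EReal) → Ω → EReal) (z : ℝ)
    (Q : Measure Ω) :
    IsEssSup m P {η | ∃ Z : Ω → ℝ, IsLinf mΩ P Z ∧
      η = fun ω => condLoss m Q Z ω - inducedRisk m P β z (fun ω' => (Z ω' : EReal)) ω}
      (minPenalty m P (inducedRisk m P β z) Q) := by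
  refine isEssSup_essSupFam hm P _ ?_
  rintro _ ⟨Z, -, rfl⟩
  exact (measurable_condLoss m Q Z).sub (isEssInf_inducedRisk hm β z _).measurable

theorem IsCPM.condLoss_sub_minPenalty_le (hβ : IsCPM m P β zd zu) (hm : m ≤ mΩ)
    (hzd : zd < (z : EReal)) (hzu : (z : EReal) < zu) {X : Ω → ℝ} (hX : IsLinf mΩ P X)
    (Q : Measure Ω) :
    ∀ᵐ ω ∂P, condLoss m Q X ω - minPenalty m P (inducedRisk m P β z) Q ω
      ≤ inducedRisk m P β z (fun ω' => (X ω' : EReal)) ω := by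
  filter_upwards [(isEssSup_minPenalty hm β z Q).le _ ⟨X, hX, rfl⟩,
    hβ.coe_toReal_inducedRisk hm hzd hzu hX] with ω h1 h2
  rw [← h2] at h1 ⊢
  rw [EReal.sub_le_iff_le_add (Or.inr (EReal.coe_ne_top _)) (Or.inr (EReal.coe_ne_bot _))]
  rwa [EReal.sub_le_iff_le_add (Or.inl (EReal.coe_ne_bot _)) (Or.inl (EReal.coe_ne_top _)),
    add_comm] at h1

/-- For a conditional subgradient `Q` at `X`, the term `Z = X` dominates every other term in the
penalty, so the penalty is at most `E^Q[-X | m] - ρ(X)`. -/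
theorem IsCPM.exists_condLoss_sub_minPenalty_eq (hβ : IsCPM m P β zd zu) (hm : m ≤ mΩ)
    (hzd : zd < (z : EReal)) (hzu : (z : EReal) < zu) {X : Ω → ℝ} (hX : IsLinf mΩ P X) :
    ∃ Q ∈ dualMeasures m P, ∀ᵐ ω ∂P,
      condLoss m Q X ω - minPenalty m P (inducedRisk m P β z) Q ω
        = inducedRisk m P β z (fun ω' => (X ω' : EReal)) ω := by
  obtain ⟨Q, hQ, -, h⟩ := (hβ.isCondRisk hm hzd hzu).exists_sub_le_condExp hm hX
  refine ⟨Q, hQ, ?_⟩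
  have hcoX := hβ.coe_toReal_inducedRisk hm hzd hzu hX
  have hle := (isEssSup_minPenalty (P := P) hm β z Q).least
    (fun ω => condLoss m Q X ω - inducedRisk m P β z (fun ω' => (X ω' : EReal)) ω)
    (((measurable_condLoss m Q X).sub (isEssInf_inducedRisk hm β z _).measurable).mono hm le_rfl)
    (by
      rintro _ ⟨Z, hZ, rfl⟩
      filter_upwards [h Z hZ, hcoX, hβ.coe_toReal_inducedRisk hm hzd hzu hZ] with ω h1 h2 h3
      rw [← h2, ← h3, condLoss, condLoss, ← EReal.coe_sub, ← EReal.coe_sub,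
        EReal.coe_le_coe_iff]
      simp only [realRisk] at h1
      linarith)
  filter_upwards [hβ.condLoss_sub_minPenalty_le hm hzd hzu hX Q, hle, hcoX] with ω h1 h2 h3
  refine le_antisymm h1 ?_
  rw [← h3] at h2 ⊢
  refine le_trans (le_of_eq ?_) (EReal.sub_le_sub le_rfl h2)
  rw [condLoss, ← EReal.coe_sub, ← EReal.coe_sub, sub_sub_cancel]

/-- One supporting measure `Q` at the limit `Y` suffices: `∫ (r Y - r (X n)) ∂P ≤ ∫ (X n - Y) ∂Q →
0`, while the left integrand decreases to a nonnegative limit, which therefore vanishes almost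
surely. -/
theorem IsCPM.continuousFromAbove_inducedRisk (hβ : IsCPM m P β zd zu) (hm : m ≤ mΩ)
    (hzd : zd < (z : EReal)) (hzu : (z : EReal) < zu) :
    ContinuousFromAbove P (inducedRisk m P β z) := by
  intro X Y hX hY h
  have hr := hβ.isCondRisk hm hzd hzu
  obtain ⟨Q, hQ, hint, -⟩ := hr.exists_sub_le_condExp hm hY
  have hQp : IsProbabilityMeasure Q := hQ.1
  set r := realRisk m P β z
  have hmono : ∀ᵐ ω ∂P, ∀ n, r (X n) ω ≤ r (X (n + 1)) ω := ae_all_iff.2 fun n =>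
    hr.anti _ _ (hX (n + 1)) (hX n) (by filter_upwards [h] with ω hω using hω.1 n.le_succ)
  have hle : ∀ᵐ ω ∂P, ∀ n, r (X n) ω ≤ r Y ω := ae_all_iff.2 fun n =>
    hr.anti _ _ hY (hX n) (by filter_upwards [h] with ω hω using hω.1.le_of_tendsto hω.2 n)
  have hbound : ∀ᵐ ω ∂P, ∀ n, |X n ω - Y ω| ≤ X 0 ω - Y ω := by
    filter_upwards [h] with ω hω n
    rw [abs_of_nonneg (sub_nonneg.2 (hω.1.le_of_tendsto hω.2 n))]
    exact sub_le_sub_right (hω.1 n.zero_le) _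
  have hlimQ : Tendsto (fun n => ∫ ω, (X n ω - Y ω) ∂Q) atTop (𝓝 0) := by
    have := tendsto_integral_of_dominated_convergence (μ := Q) (F := fun n ω => X n ω - Y ω)
      (f := fun _ => (0 : ℝ)) (fun ω => X 0 ω - Y ω)
      (fun n => (((hX n).sub hY).integrable hQ.2.1).aestronglyMeasurable)
      (((hX 0).sub hY).integrable hQ.2.1)
      (fun n => by filter_upwards [hQ.2.1.ae_le hbound] with ω hω using hω n)
      (by
        filter_upwards [hQ.2.1.ae_le h] with ω hω
        simpa using hω.2.sub_const (Y ω))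
    simpa using this
  have hlim : ∀ᵐ ω ∂P, Tendsto (fun n => r (X n) ω) atTop (𝓝 (⨆ n, r (X n) ω)) := by
    filter_upwards [hmono, hle] with ω h1 h2
    exact tendsto_atTop_ciSup (monotone_nat_of_le_succ h1) ⟨r Y ω, by rintro _ ⟨n, rfl⟩; exact h2 n⟩
  obtain ⟨c, hc⟩ := (hr.isLinf_sub hm hY (hX 0)).2
  have hdom : ∀ᵐ ω ∂P, ∀ n, |r Y ω - r (X n) ω| ≤ c := by
    filter_upwards [hc, hmono, hle] with ω h1 h2 h3 n
    rw [abs_of_nonneg (sub_nonneg.2 (h3 n))]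
    exact (sub_le_sub_left (monotone_nat_of_le_succ h2 n.zero_le) _).trans ((le_abs_self _).trans h1)
  have hlimP : Tendsto (fun n => ∫ ω, (r Y ω - r (X n) ω) ∂P) atTop
      (𝓝 (∫ ω, (r Y ω - ⨆ n, r (X n) ω) ∂P)) := by
    refine tendsto_integral_of_dominated_convergence (fun _ => c)
      (fun n => (hr.integrable_sub hm hY (hX n)).aestronglyMeasurable) (integrable_const c)
      (fun n => by filter_upwards [hdom] with ω hω using hω n) ?_
    filter_upwards [hlim] with ω hω using hω.const_sub _
  have hnn : 0 ≤ᵐ[P] fun ω => r Y ω - ⨆ n, r (X n) ω := by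
    filter_upwards [hle] with ω hω
    exact sub_nonneg.2 (ciSup_le hω)
  have hint0 : ∫ ω, (r Y ω - ⨆ n, r (X n) ω) ∂P = 0 :=
    le_antisymm (le_of_tendsto_of_tendsto' hlimP hlimQ fun n => hint _ (hX n))
      (integral_nonneg_of_ae hnn)
  have hInt : Integrable (fun ω => r Y ω - ⨆ n, r (X n) ω) P := by
    refine Integrable.of_bound (aestronglyMeasurable_of_tendsto_ae atTop
      (f := fun n ω => r Y ω - r (X n) ω)
      (fun n => (hr.integrable_sub hm hY (hX n)).aestronglyMeasurable) ?_) c ?_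
    · filter_upwards [hlim] with ω hω using hω.const_sub _
    · filter_upwards [hlim, hdom] with ω h1 h2
      exact le_of_tendsto (h1.const_sub (r Y ω)).abs (Eventually.of_forall h2)
  have hzero := (integral_eq_zero_iff_of_nonneg_ae hnn hInt).1 hint0
  filter_upwards [hzero, hlim, hmono, hβ.coe_toReal_inducedRisk hm hzd hzu hY,
    ae_all_iff.2 fun n => hβ.coe_toReal_inducedRisk hm hzd hzu (hX n)] with ω h1 h2 h3 h4 h5
  refine ⟨fun i j hij => ?_, ?_⟩
  · exact (h5 i).symm.le.trans
      ((EReal.coe_le_coe_iff.2 (monotone_nat_of_le_succ h3 hij)).trans (h5 j).le)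
  have h6 : (⨆ n, r (X n) ω) = r Y ω := (sub_eq_zero.1 h1).symm
  rw [h6] at h2
  rw [← h4]
  exact ((continuous_coe_real_ereal.tendsto _).comp h2).congr h5

/-- `Q n` is a maximizer for the bounded position `X ∧ n`. Its `toReal` loses information only on
the null event `X = ⊥`. -/
theorem IsCPM.exists_seq_tendsto_inducedRisk (hβ : IsCPM m P β zd zu) (hm : m ≤ mΩ)
    (hzd : zd < (z : EReal)) (hzu : (z : EReal) < zu) {X : Ω → EReal} (hX : IsLbb mΩ P X) :
    ∃ Q : ℕ → Measure Ω, (∀ n, Q n ∈ dualMeasures m P) ∧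
      ∀ᵐ ω ∂P, Tendsto (fun n : ℕ =>
          condLoss m (Q n) (fun ω' => (min (X ω') ((n : ℝ) : EReal)).toReal) ω
            - minPenalty m P (inducedRisk m P β z) (Q n) ω)
        atTop (𝓝 (inducedRisk m P β z X ω)) := by
  have hL := fun n : ℕ => (hX.isLinf_toReal_min (n : ℝ)).1
  choose Q hQ hQe using fun n : ℕ => hβ.exists_condLoss_sub_minPenalty_eq hm hzd hzu (hL n)
  refine ⟨Q, hQ, ?_⟩
  have hlim := hβ.inducedRisk_tendsto_of_monotone hm hzd hzu (fun n => (hL n).isLbb) hX (by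
    filter_upwards [ae_all_iff.2 fun n : ℕ => (hX.isLinf_toReal_min (n : ℝ)).2] with ω hω
    simp only [hω]
    refine ⟨fun i j hij => min_le_min_left _ (by exact_mod_cast hij), ?_⟩
    have := (tendsto_const_nhds (x := X ω)).min
      (EReal.tendsto_coe_nhds_top_iff.2 (tendsto_natCast_atTop_atTop (R := ℝ)))
    simpa using this)
  filter_upwards [hlim, ae_all_iff.2 hQe] with ω h1 h2
  simpa only [h2] using h1

end Duality

end CondPerf

theorem mainTheorem6 {Ω : Type*} (m : MeasurableSpace Ω) {mΩ : MeasurableSpace Ω} (hm : m ≤ mΩ)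
    (P : Measure Ω) [IsProbabilityMeasure P]
    (β : (Ω → EReal) → Ω → EReal) (zd zu : EReal) (hβ : CondPerf.IsCPM m P β zd zu)
    (z : ℝ) (hzd : zd < (z : EReal)) (hzu : (z : EReal) < zu) :
    (∀ X : Ω → ℝ, CondPerf.IsLinf mΩ P X →
      CondPerf.IsEssMax P
        {η | ∃ Q ∈ CondPerf.dualMeasures m P, η = fun ω =>
          CondPerf.condLoss m Q X ω
            - CondPerf.minPenalty m P (CondPerf.inducedRisk m P β z) Q ω}
        (CondPerf.inducedRisk m P β z (fun ω => (X ω : EReal)))) ∧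
    CondPerf.ContinuousFromAbove P (CondPerf.inducedRisk m P β z) ∧
    (∀ X : Ω → EReal, CondPerf.IsLbb mΩ P X →
      ∃ Q : ℕ → Measure Ω, (∀ n, Q n ∈ CondPerf.dualMeasures m P) ∧
        ∀ᵐ ω ∂P, Tendsto
          (fun n : ℕ =>
            CondPerf.condLoss m (Q n) (fun ω' => (min (X ω') ((n : ℝ) : EReal)).toReal) ω
              - CondPerf.minPenalty m P (CondPerf.inducedRisk m P β z) (Q n) ω)
          atTop (𝓝 (CondPerf.inducedRisk m P β z X ω))) := by

  refine ⟨fun X hX => ⟨?_, ?_⟩, hβ.continuousFromAbove_inducedRisk hm hzd hzu,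
    fun X hX => hβ.exists_seq_tendsto_inducedRisk hm hzd hzu hX⟩
  · rintro _ ⟨Q, -, rfl⟩
    exact hβ.condLoss_sub_minPenalty_le hm hzd hzu hX Q
  · obtain ⟨Q, hQ, h⟩ := hβ.exists_condLoss_sub_minPenalty_eq hm hzd hzu hX
    exact ⟨_, ⟨Q, hQ, rfl⟩, h⟩
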